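/- \textbf{Setting.} Consider a discounted Markov decision process with measurable state space $\mathcal S$, measurable action space $\mathcal A$, transition kernel $P(\cdot\mid s,a)$, measurable reward $r(s,a,s')\in[-1,1]$ and discount factor $\gamma\in[0,1)$, and let $\rho$ be an initial state distribution. For $\theta\in\mathbb R^d$ let $\pi_\theta(\cdot\mid s)$ be a policy given by a positive density $a\mapsto\pi_\theta(a\mid s)$ with respect to a fixed $\sigma$-finite measure on $\mathcal A$. Let $p_\theta$ be the law of the trajectory $\tau=(s^0,a^0,s^1,a^1,\dots)$ with $s^0\sim\rho$, $a^h\sim\pi_\theta(\cdot\mid s^h)$, $s^{h+1}\sim P(\cdot\mid s^h,a^h)$, and put $r^h=r(s^h,a^h,s^{h+1})$, $$J_\rho(\theta)=\mathbb E_{\tau\sim p_\theta}\Big[\sum_{h=0}^\infty\gamma^h r^h\Big],\qquad J_\rho^H(\theta)=\mathbb E_{\tau\sim p_\theta}\Big[\sum_{h=0}^{H-1}\gamma^h r^h\Big].$$ Let $d_{\rho,\pi_\theta}=(1-\gamma)\sum_{h\ge0}\gamma^h\,\mathrm{Law}_{p_\theta}(s^h)$, $\tilde d_{\rho,\pi_\theta}(ds,da)=d_{\rho,\pi_\theta}(ds)\,\pi_\theta(da\mid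 s)$, and let $$F(\theta)=\mathbb E_{(s,a)\sim\tilde d_{\rho,\pi_\theta}}\big[\nabla\log\pi_\theta(a\mid s)\,(\nabla\log\pi_\theta(a\mid s))^{\mathsf T}\big]$$ be the Fisher information matrix; all gradients are taken in $\theta$. \textbf{Assumptions.} There are $\mu_F>0$ with $F(\theta)\succeq\mu_F I_d$ for all $\theta$, and $M_g,M_h>0$ such that, for all $s,a$, $\theta\mapsto\log\pi_\theta(a\mid s)$ is twice differentiable with $\|\nabla\log\pi_\theta(a\mid s)\|^2\le M_g$ and $\|\nabla^2\log\pi_\theta(a\mid s)\|\le M_h$ (spectral norm) for all $\theta$. Put $$L=\frac{M_g+M_h}{(1-\gamma)^2},\qquad G_g=\frac{\sqrt{M_g}}{1-\gamma}\sqrt{\frac1{1-\gamma}+H}.$$ \textbf{Algorithm.} Fix integers $H,K\ge0$ and real sequences $(\alpha_t)$, $(\beta_t)$. Put $R_h(\tau)=\sum_{i=h}^{H-1}\gamma^ir^i$, $g(\tau;\theta)=\sum_{h=0}^{H-1}R_h(\tau)\nabla\log\pi_\theta(a^h\mid s^h)$, $\phi(\tau;\theta)=\sum_{h=0}^{H-1}R_h(\tau)\log\pi_\theta(a^h\mid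 s^h)$ and $\mathcal H(\tau;\theta)=\nabla\phi(\tau;\theta)\big(\sum_{h=0}^{H-1}\nabla\log\pi_\theta(a^h\mid s^h)\big)^{\mathsf T}+\nabla^2\phi(\tau;\theta)$. Starting at $\theta_1\in\mathbb R^d$, the iterates are, for $t\ge1$: \begin{itemize} \item $u_1=g(\tau_1;\theta_1)$, and for $t\ge2$, with $\hat\theta_t=q_t\theta_t+(1-q_t)\theta_{t-1}$, $$u_t=\beta_t\,g(\tau_t;\theta_t)+(1-\beta_t)\big(u_{t-1}+\mathcal H(\hat\tau_t;\hat\theta_t)(\theta_t-\theta_{t-1})\big);$$ \item $w_t=\frac1{K+1}\sum_{k=0}^Kw_t^k$, where $w_t^0\in\mathbb R^d$ is given and, with $x_{t,k}=\nabla\log\pi_{\theta_t}(a_{t,k}\mid s_{t,k})$, $$w_t^{k+1}=w_t^k-\frac1{4M_g}\big(\langle w_t^k,x_{t,k}\rangle x_{t,k}-u_t\big);$$ \item $\theta_{t+1}=\theta_t+\alpha_tw_t$. \end{itemize} Here $\tau_t\sim p_{\theta_t}$, $\hat\tau_t\sim p_{\hat\theta_t}$, $q_t\in[0,1]$ and $(s_{t,k},a_{t,k})\sim\tilde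 d_{\rho,\pi_{\theta_t}}$ are the random draws of iteration $t$. \textbf{Lemma.} The functions $J_\rho$ and $J_\rho^H$ are differentiable on $\mathbb R^d$, and for every realization of the random draws and every integer $t\ge1$ with $0\le\alpha_t\le\frac{\mu_F}{2L}$, $$\begin{aligned}J_\rho(\theta_{t+1})\ \ge\ J_\rho(\theta_t)&+\frac{\alpha_t\mu_F}2\|w_t^*\|^2+\frac{\alpha_t\mu_F}4\|w_t\|^2-\frac{2\alpha_tM_g}{\mu_F^2}G_g^2\gamma^{2H}\\&-\frac{2\alpha_tM_g}{\mu_F^2}\big\|\nabla J_\rho^H(\theta_t)-u_t\big\|^2-\alpha_tM_g\|w_t-\hat w_t\|^2,\end{aligned}$$ where $w_t^*=F^{-1}(\theta_t)\nabla J_\rho(\theta_t)$ and $\hat w_t=F^{-1}(\theta_t)u_t$. -/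

import Mathlib

open MeasureTheory ProbabilityTheory
open scoped Gradient

noncomputable section

namespace NPGHM

/-- The parameter space `ℝ^d` with its Euclidean norm. -/
abbrev Param (d : ℕ) : Type := EuclideanSpace ℝ (Fin d)

/-- A discounted Markov decision process on measurable state and action spaces, with transition
probabilities `P(· | s, a)`, rewards `r(s, a, s') ∈ [-1, 1]` and discount factor `γ ∈ [0, 1)`. -/
structure MDP (S A : Type*) [MeasurableSpace S] [MeasurableSpace A] where
  P : Kernel (S × A) S
  markov : IsMarkovKernel P
  r : S → A → S → ℝ
  measurable_r : Measurable fun x : S × A × S => r x.1 x.2.1 x.2.2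
  abs_r_le : ∀ s a s', |r s a s'| ≤ 1
  γ : ℝ
  γ_nonneg : 0 ≤ γ
  γ_lt_one : γ < 1

/-- A family of stochastic policies `π_θ(· | s)`, `θ ∈ ℝ^d`, given by positive probability densities
`a ↦ π_θ(a | s)` with respect to a reference measure `ν` on the action space (counting measure for
discrete actions, Lebesgue measure for continuous ones). -/
structure PolicyClass (d : ℕ) (S : Type*) {A : Type*} [MeasurableSpace S] [MeasurableSpace A]
    (ν : Measure A) where
  dens : Param d → S → A → ℝ
  measurable_dens : ∀ θ, Measurable (Function.uncurry (dens θ))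
  dens_pos : ∀ θ s a, 0 < dens θ s a
  lintegral_dens : ∀ θ s, ∫⁻ a, ENNReal.ofReal (dens θ s a) ∂ν = 1

section Policy

variable {d : ℕ} {S A : Type*} [MeasurableSpace S] [MeasurableSpace A] {ν : Measure A}

/-- `log π_θ(a | s)` as a function of `θ`. -/
def PolicyClass.logDens (pol : PolicyClass d S ν) (s : S) (a : A) (θ : Param d) : ℝ :=
  Real.log (pol.dens θ s a)

/-- The score `∇ log π_θ(a | s)`, the gradient being taken in `θ`. -/
def PolicyClass.score (pol : PolicyClass d S ν) (θ : Param d) (s : S) (a : A) : Param d :=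
  ∇ (pol.logDens s a) θ

/-- For all `s`, `a`, the log-density `θ ↦ log π_θ(a | s)` is twice differentiable, with
`‖∇ log π_θ(a | s)‖² ≤ M_g` and `‖∇² log π_θ(a | s)‖ ≤ M_h` (spectral norm). -/
structure PolicyClass.LogDensityBounds (pol : PolicyClass d S ν) (Mg Mh : ℝ) : Prop where
  differentiable : ∀ s a, Differentiable ℝ (pol.logDens s a)
  differentiable_gradient : ∀ s a, Differentiable ℝ (∇ (pol.logDens s a))
  norm_score_sq_le : ∀ θ s a, ‖pol.score θ s a‖ ^ 2 ≤ Mg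
  norm_hessian_le : ∀ θ s a, ‖fderiv ℝ (∇ (pol.logDens s a)) θ‖ ≤ Mh

variable [SigmaFinite ν]

/-- The policy `π_θ` as a kernel from states to actions. -/
def PolicyClass.kernel (pol : PolicyClass d S ν) (θ : Param d) : Kernel S A :=
  Kernel.withDensity (Kernel.const S ν) fun s a => ENNReal.ofReal (pol.dens θ s a)

instance (pol : PolicyClass d S ν) (θ : Param d) : IsMarkovKernel (pol.kernel θ) := by
  refine ⟨fun s => ⟨?_⟩⟩
  have hm : Measurable (Function.uncurry fun s a => ENNReal.ofReal (pol.dens θ s a)) :=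
    ENNReal.measurable_ofReal.comp (pol.measurable_dens θ)
  rw [PolicyClass.kernel, Kernel.withDensity_apply' _ hm]
  simpa using pol.lintegral_dens θ s

end Policy

/-- State-action trajectories `(s^0, a^0, s^1, a^1, …)`. -/
abbrev Traj (S A : Type*) : Type _ := ℕ → S × A

section Model

variable {d : ℕ} {S A : Type*} [MeasurableSpace S] [MeasurableSpace A] {ν : Measure A}

/-- The reward `r^h = r(s^h, a^h, s^{h+1})` along a trajectory. -/
def MDP.reward (M : MDP S A) (τ : Traj S A) (h : ℕ) : ℝ :=
  M.r (τ h).1 (τ h).2 (τ (h + 1)).1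

section Law

variable [SigmaFinite ν]

/-- One step of the state-action chain: from `(s, a)` draw `s' ∼ P(· | s, a)`, then
`a' ∼ π_θ(· | s')`. -/
def MDP.step (M : MDP S A) (pol : PolicyClass d S ν) (θ : Param d) : Kernel (S × A) (S × A) :=
  M.P ⊗ₖ Kernel.prodMkLeft (S × A) (pol.kernel θ)

instance (M : MDP S A) (pol : PolicyClass d S ν) (θ : Param d) : IsMarkovKernel (M.step pol θ) := by
  have := M.markov
  unfold MDP.step
  infer_instance

/-- The same step, seen as a kernel on histories up to time `n`. -/
def MDP.historyStep (M : MDP S A) (pol : PolicyClass d S ν) (θ : Param d) (n : ℕ) :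
    Kernel ((i : Finset.Iic n) → (fun _ : ℕ => S × A) i) (S × A) :=
  (M.step pol θ).comap (fun x => x ⟨n, Finset.mem_Iic.2 le_rfl⟩) (measurable_pi_apply _)

instance (M : MDP S A) (pol : PolicyClass d S ν) (θ : Param d) (n : ℕ) :
    IsMarkovKernel (M.historyStep pol θ n) := by
  unfold MDP.historyStep
  infer_instance

/-- The trajectory law `p_θ`: `s^0 ∼ ρ`, `a^h ∼ π_θ(· | s^h)`, `s^{h+1} ∼ P(· | s^h, a^h)`. -/
def MDP.trajLaw (M : MDP S A) (pol : PolicyClass d S ν) (ρ : Measure S) (θ : Param d) :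
    Measure (Traj S A) :=
  Kernel.trajMeasure (X := fun _ : ℕ => S × A) (ρ ⊗ₘ pol.kernel θ) (M.historyStep pol θ)

/-- The objective `J_ρ(θ) = E_{τ ∼ p_θ} ∑_{h ≥ 0} γ^h r^h`. -/
def MDP.J (M : MDP S A) (pol : PolicyClass d S ν) (ρ : Measure S) (θ : Param d) : ℝ :=
  ∫ τ, ∑' h, M.γ ^ h * M.reward τ h ∂(M.trajLaw pol ρ θ)

/-- The truncated objective `J_ρ^H(θ) = E_{τ ∼ p_θ} ∑_{h < H} γ^h r^h`. -/
def MDP.JH (M : MDP S A) (pol : PolicyClass d S ν) (ρ : Measure S) (H : ℕ) (θ : Param d) : ℝ :=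
  ∫ τ, ∑ h ∈ Finset.range H, M.γ ^ h * M.reward τ h ∂(M.trajLaw pol ρ θ)

/-- The state visitation distribution `d_{ρ,π_θ} = (1 - γ) ∑_h γ^h Law(s^h)`. -/
def MDP.stateVisitation (M : MDP S A) (pol : PolicyClass d S ν) (ρ : Measure S) (θ : Param d) :
    Measure S :=
  Measure.sum fun h : ℕ =>
    ENNReal.ofReal ((1 - M.γ) * M.γ ^ h) • (M.trajLaw pol ρ θ).map fun τ => (τ h).1

/-- The state-action visitation distribution `d_{ρ,π_θ}(s) π_θ(a | s)`. -/
def MDP.visitation (M : MDP S A) (pol : PolicyClass d S ν) (ρ : Measure S) (θ : Param d) :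
    Measure (S × A) :=
  M.stateVisitation pol ρ θ ⊗ₘ pol.kernel θ

/-- The Fisher information matrix, i.e. the expectation of `∇ log π_θ(a|s) (∇ log π_θ(a|s))ᵀ`
under the state-action visitation distribution. -/
def MDP.fisher (M : MDP S A) (pol : PolicyClass d S ν) (ρ : Measure S) (θ : Param d) :
    Matrix (Fin d) (Fin d) ℝ :=
  Matrix.of fun i j => ∫ x, pol.score θ x.1 x.2 i * pol.score θ x.1 x.2 j ∂(M.visitation pol ρ θ)

/-- Fisher non-degeneracy with constant `μ_F`: `F(θ) ≽ μ_F I` for every `θ`. -/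
def MDP.FisherNonDegenerate (M : MDP S A) (pol : PolicyClass d S ν) (ρ : Measure S) (μF : ℝ) :
    Prop :=
  0 < μF ∧ ∀ θ, (M.fisher pol ρ θ - μF • (1 : Matrix (Fin d) (Fin d) ℝ)).PosSemidef

/-- `F(θ)⁻¹ v`. -/
def MDP.fisherInv (M : MDP S A) (pol : PolicyClass d S ν) (ρ : Measure S) (θ v : Param d) :
    Param d :=
  WithLp.toLp 2 (Matrix.mulVec (M.fisher pol ρ θ)⁻¹ v.ofLp)

end Law

/-- The reward-to-go `∑_{i=h}^{H-1} γ^i r^i`. -/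
def MDP.rewardToGo (M : MDP S A) (H : ℕ) (τ : Traj S A) (h : ℕ) : ℝ :=
  ∑ i ∈ Finset.Ico h H, M.γ ^ i * M.reward τ i

/-- The truncated gradient estimator `g(τ; θ)`. -/
def MDP.gradEst (M : MDP S A) (pol : PolicyClass d S ν) (H : ℕ) (τ : Traj S A) (θ : Param d) :
    Param d :=
  ∑ h ∈ Finset.range H, M.rewardToGo H τ h • pol.score θ (τ h).1 (τ h).2

/-- `φ(τ; θ) = ∑_{h<H} (∑_{i=h}^{H-1} γ^i r^i) log π_θ(a^h | s^h)`. -/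
def MDP.phi (M : MDP S A) (pol : PolicyClass d S ν) (H : ℕ) (τ : Traj S A) (θ : Param d) : ℝ :=
  ∑ h ∈ Finset.range H, M.rewardToGo H τ h * pol.logDens (τ h).1 (τ h).2 θ

/-- `log p_θ(τ)` for the trajectory truncated at `H`, up to the terms coming from `ρ` and `P`: these
do not depend on `θ`, and only the gradient in `θ` is used. -/
def PolicyClass.logTraj (pol : PolicyClass d S ν) (H : ℕ) (τ : Traj S A) (θ : Param d) : ℝ :=
  ∑ h ∈ Finset.range H, pol.logDens (τ h).1 (τ h).2 θ

/-- The truncated Hessian estimator `∇φ(τ; θ) (∇ log p_θ(τ))ᵀ + ∇²φ(τ; θ)`, applied to `x`. -/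
def MDP.hessEst (M : MDP S A) (pol : PolicyClass d S ν) (H : ℕ) (τ : Traj S A) (θ x : Param d) :
    Param d :=
  inner ℝ (∇ (pol.logTraj H τ) θ) x • ∇ (M.phi pol H τ) θ + fderiv ℝ (∇ (M.phi pol H τ)) θ x

/-- The NPG-SGD iterates `w^0, w^1, …` at `θ` for the gradient estimate `u`, with step size
`η = 1 / (4 M_g)`; `z k` is the state-action pair sampled at step `k`. -/
def PolicyClass.sgdIter (pol : PolicyClass d S ν) (Mg : ℝ) (θ u w0 : Param d) (z : ℕ → S × A) :
    ℕ → Param d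
  | 0 => w0
  | k + 1 =>
    let w := PolicyClass.sgdIter pol Mg θ u w0 z k
    let x := pol.score θ (z k).1 (z k).2
    w - (1 / (4 * Mg)) • (inner ℝ w x • x - u)

/-- The output of NPG-SGD: the average of `w^0, …, w^K`. -/
def PolicyClass.npgSGD (pol : PolicyClass d S ν) (Mg : ℝ) (K : ℕ) (θ u w0 : Param d)
    (z : ℕ → S × A) : Param d :=
  (1 / ((K : ℝ) + 1)) • ∑ k ∈ Finset.range (K + 1), pol.sgdIter Mg θ u w0 z k

/-- The random draws made in one iteration of NPG-HM: the trajectories `τ_t` and `τ̂_t`, the number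
`q_t ∈ [0, 1]` and the state-action pairs used by NPG-SGD. -/
structure Sample (S A : Type*) where
  τ : Traj S A
  τhat : Traj S A
  q : unitInterval
  z : ℕ → S × A

/-- `θ t, u t, w t` (`t ≥ 1`) are the iterates of NPG-HM started at `θ₁`, with horizon `H`, momentum
coefficients `β t`, step sizes `α t`, `K` inner iterations started at `w0 t`, when the draws of
iteration `t` have the values `ω t`. -/
structure MDP.IsRun (M : MDP S A) (pol : PolicyClass d S ν) (Mg : ℝ) (H K : ℕ) (α β : ℕ → ℝ)
    (θ₁ : Param d) (w0 : ℕ → Param d) (ω : ℕ → Sample S A) (θ u w : ℕ → Param d) : Prop where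
  init : θ 1 = θ₁
  u_one : u 1 = M.gradEst pol H (ω 1).τ (θ 1)
  u_succ : ∀ t, 1 ≤ t → u (t + 1) =
    β (t + 1) • M.gradEst pol H (ω (t + 1)).τ (θ (t + 1)) +
      (1 - β (t + 1)) • (u t +
        M.hessEst pol H (ω (t + 1)).τhat
          (((ω (t + 1)).q : ℝ) • θ (t + 1) + (1 - ((ω (t + 1)).q : ℝ)) • θ t)
          (θ (t + 1) - θ t))
  w_eq : ∀ t, 1 ≤ t → w t = pol.npgSGD Mg K (θ t) (u t) (w0 t) (ω t).z
  θ_succ : ∀ t, 1 ≤ t → θ (t + 1) = θ t + α t • w t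

/-- The smoothness constant `L = (M_g + M_h) / (1 - γ)²`. -/
def MDP.L (M : MDP S A) (Mg Mh : ℝ) : ℝ :=
  1 / (1 - M.γ) ^ 2 * (Mg + Mh)

/-- The truncation constant `G_g = √M_g / (1 - γ) * √(1 / (1 - γ) + H)`. -/
def MDP.Gg (M : MDP S A) (Mg : ℝ) (H : ℕ) : ℝ :=
  √Mg / (1 - M.γ) * √(1 / (1 - M.γ) + H)

end Model

end NPGHM

end

/-!
The inequality measures the progress of a single update `θ_{t+1} = θ_t + α_t w_t`, in terms of the
errors of `u_t` as an estimate of the gradient and of `w_t` as an estimate of `F⁻¹ u_t`. Three facts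
about the objective and the Fisher matrix carry it.

* `J_ρ` is `L`-smooth. The state-action pairs form a Markov chain, and along a line
  `t ↦ θ + t δ` the law of its first `h + 1` points has the likelihood ratio `exp C(t)` with
  respect to the law at `θ`, where `C(t)` is the sum over the chain of the increments of the
  log-density. Hence the expectation of the reward at time `h` may be differentiated twice under the
  integral sign, at a fixed probability measure, and its second derivative is an expectation, under
  the tilted law, of the reward times `S² + S'`, where `S = C'(t)` and `S' = C''(t)`. The increments
  of `S` are centred given the past, since each policy density has integral one; so the second
  moment of `S` is at most `(h + 1) M_g ‖δ‖²` (`integral_pathProd_mul_pathSum_sq_le`), linear in `h`.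
  This gives a quadratic remainder with constant `(h + 1) (M_g + M_h) / 2`
  (`PolicyClass.LogDensityBounds.abs_meanReward_sub_le`). Summed against `γ^h`, these expansions give
  at once the differentiability of `J_ρ`, its gradient and its smoothness
  (`PolicyClass.LogDensityBounds.abs_J_sub_le`).
* The same second moment bounds the gradient of the reward at time `h` by `√((h + 1) M_g)`, and the
  tail of the series for the gradient is then at most `G_g γ^H`
  (`PolicyClass.LogDensityBounds.norm_gradJ_sub_le`).
* The Fisher matrix is symmetric and satisfies `μ_F I ≼ F ≼ M_g I`.

The step itself is polarization in the inner product defined by `F`: with `∇J = F w*`,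
`2⟨∇J, w⟩ = ⟨F w*, w*⟩ + ⟨F w, w⟩ - ⟨F (w - w*), w - w*⟩`, the last term being split at `F⁻¹ u`
(`natural_gradient_step`).
-/

noncomputable section

namespace NPGHM

/-! ### Differentiation of bounded parametric integrals -/

section Chain

/-- A pointwise derivative of measurable functions is a limit of difference quotients, hence
measurable. -/
lemma measurable_of_hasDerivAt {Ω : Type*} [MeasurableSpace Ω] {F : ℝ → Ω → ℝ} {F' : Ω → ℝ}
    {t : ℝ} (hF : ∀ s, Measurable (F s)) (hd : ∀ ω, HasDerivAt (fun s => F s ω) (F' ω) t) :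
    Measurable F' := by
  have hu : Filter.Tendsto (fun n : ℕ => ((n : ℝ) + 1)⁻¹) Filter.atTop (nhdsWithin 0 {0}ᶜ) := by
    refine tendsto_nhdsWithin_iff.2 ⟨?_, Filter.Eventually.of_forall fun n => ?_⟩
    · simpa using tendsto_one_div_add_atTop_nhds_zero_nat (𝕜 := ℝ)
    · have : ((n : ℝ) + 1)⁻¹ ≠ 0 := by positivity
      simpa using this
  refine measurable_of_tendsto_metrizable
    (f := fun n : ℕ => fun ω => (((n : ℝ) + 1)⁻¹)⁻¹ • (F (t + ((n : ℝ) + 1)⁻¹) ω - F t ω)) ?_ ?_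
  · intro n
    simp only [smul_eq_mul]
    exact ((hF _).sub (hF _)).const_mul _
  · refine tendsto_pi_nhds.2 fun ω => ?_
    exact (hasDerivAt_iff_tendsto_slope_zero.1 (hd ω)).comp hu

lemma integrable_of_abs_le {Ω : Type*} [MeasurableSpace Ω] {μ : Measure Ω} [IsFiniteMeasure μ]
    {f : Ω → ℝ} (hf : Measurable f) (C : ℝ) (hC : ∀ ω, |f ω| ≤ C) : Integrable f μ :=
  Integrable.of_bound hf.aestronglyMeasurable C (Filter.Eventually.of_forall hC)

/-- Differentiation under the integral sign for a derivative that is bounded uniformly on the unit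
ball around the point. -/
lemma hasDerivAt_integral_of_bounded {Ω : Type*} [MeasurableSpace Ω] (μ : Measure Ω)
    [IsFiniteMeasure μ] {F F' : ℝ → Ω → ℝ} (hF : ∀ t, Measurable (F t))
    (hd : ∀ t ω, HasDerivAt (fun s => F s ω) (F' t ω) t) (t : ℝ) {B C : ℝ}
    (hB : ∀ ω, |F t ω| ≤ B) (hC : ∀ s ∈ Metric.ball t 1, ∀ ω, |F' s ω| ≤ C) :
    HasDerivAt (fun s => ∫ ω, F s ω ∂μ) (∫ ω, F' t ω ∂μ) t :=
  (hasDerivAt_integral_of_dominated_loc_of_deriv_le (bound := fun _ => C)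
    (Metric.ball_mem_nhds t one_pos)
    (Filter.Eventually.of_forall fun s => (hF s).aestronglyMeasurable)
    (integrable_of_abs_le (hF t) B hB)
    (measurable_of_hasDerivAt hF (hd t)).aestronglyMeasurable
    (Filter.Eventually.of_forall fun ω s hs => hC s hs ω) (integrable_const C)
    (Filter.Eventually.of_forall fun ω s _ => hd s ω)).2

/-- Second-order Taylor bound on `[0, 1]` from a bound on the second derivative. -/
lemma abs_taylor_one_le {f f' f'' : ℝ → ℝ} {C : ℝ} (h1 : ∀ t, HasDerivAt f (f' t) t)
    (h2 : ∀ t, HasDerivAt f' (f'' t) t) (hC : ∀ t, |f'' t| ≤ C) :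
    |f 1 - f 0 - f' 0| ≤ C / 2 := by
  -- It is enough to bound one side, for `f` and for `-f`.
  have key : ∀ g g' g'' : ℝ → ℝ, (∀ t, HasDerivAt g (g' t) t) → (∀ t, HasDerivAt g' (g'' t) t) →
      (∀ t, |g'' t| ≤ C) → g 1 - g 0 - g' 0 ≤ C / 2 := by
    intro g g' g'' k1 k2 k3
    have hlip : ∀ t, 0 ≤ t → g' t - g' 0 ≤ C * t := by
      intro t ht
      have hconv : Convex ℝ (Set.univ : Set ℝ) := convex_univ
      have := hconv.norm_image_sub_le_of_norm_hasDerivWithin_le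
        (fun s _ => (k2 s).hasDerivWithinAt) (fun s _ => k3 s) (Set.mem_univ 0) (Set.mem_univ t)
      rw [sub_zero, Real.norm_eq_abs, Real.norm_eq_abs, abs_of_nonneg ht] at this
      exact (le_abs_self _).trans this
    have hd : ∀ t, HasDerivAt (fun t => g t - g' 0 * t - C / 2 * t ^ 2)
        (g' t - g' 0 - C * t) t := by
      intro t
      have := ((k1 t).sub ((hasDerivAt_id t).const_mul (g' 0))).sub
        ((hasDerivAt_pow 2 t).const_mul (C / 2))
      refine this.congr_deriv ?_
      push_cast
      ring
    have hanti : AntitoneOn (fun t => g t - g' 0 * t - C / 2 * t ^ 2) (Set.Icc 0 1) := by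
      refine antitoneOn_of_deriv_nonpos (convex_Icc 0 1)
        (fun t _ => (hd t).continuousAt.continuousWithinAt)
        (fun t _ => (hd t).differentiableAt.differentiableWithinAt) fun t ht => ?_
      rw [interior_Icc] at ht
      rw [(hd t).deriv]
      linarith [hlip t ht.1.le]
    have := hanti (Set.left_mem_Icc.2 zero_le_one) (Set.right_mem_Icc.2 zero_le_one) zero_le_one
    linarith
  have h := key f f' f'' h1 h2 hC
  have h' := key (fun t => - f t) (fun t => - f' t) (fun t => - f'' t) (fun t => (h1 t).neg)
    (fun t => (h2 t).neg) (fun t => by simpa using hC t)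
  rw [abs_le]
  constructor <;> linarith

/-! ### Laws of Markov chains -/

variable {X : Type*} [MeasurableSpace X]

/-- The law on `ℕ → X` of the time-homogeneous Markov chain with initial distribution `μ₀` and
transition kernel `κ`. -/
def chainLaw (μ₀ : Measure X) (κ : Kernel X X) [IsMarkovKernel κ] : Measure (ℕ → X) :=
  Kernel.trajMeasure (X := fun _ : ℕ => X) μ₀ fun n =>
    κ.comap (fun x : (i : Finset.Iic n) → X => x ⟨n, Finset.mem_Iic.2 le_rfl⟩)
      (measurable_pi_apply _)

variable (μ₀ : Measure X) (κ : Kernel X X) [IsMarkovKernel κ]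

instance [IsProbabilityMeasure μ₀] : IsProbabilityMeasure (chainLaw μ₀ κ) := by
  unfold chainLaw; infer_instance

lemma chainLaw_map_zero : (chainLaw μ₀ κ).map (fun τ => τ 0) = μ₀ := by
  have h : (fun τ : ℕ → X => τ 0) = (fun x : (i : Finset.Iic 0) → X =>
      x ⟨0, Finset.mem_Iic.2 le_rfl⟩) ∘ Preorder.frestrictLe (π := fun _ : ℕ => X) 0 := rfl
  rw [h, ← Measure.map_map (measurable_pi_apply _) (by fun_prop), chainLaw, Kernel.trajMeasure,
    Measure.map_comp _ _ (by fun_prop), Kernel.traj_map_frestrictLe, Kernel.partialTraj_self,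
    Measure.id_comp, Measure.map_map (measurable_pi_apply _) (by fun_prop)]
  exact Measure.map_id

lemma integral_chainLaw_zero {f : X → ℝ} (hf : Measurable f) :
    ∫ τ, f (τ 0) ∂(chainLaw μ₀ κ) = ∫ x, f x ∂μ₀ := by
  conv_rhs => rw [← chainLaw_map_zero μ₀ κ]
  rw [integral_map (measurable_pi_apply 0).aemeasurable hf.aestronglyMeasurable]

variable [IsProbabilityMeasure μ₀]

/-- The Markov property: the integrand `g τ (τ (n + 1))`, where `g τ` depends on the chain up to
time `n` only, may be averaged over the transition from time `n` to time `n + 1`. -/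
lemma integral_chainLaw_succ (n : ℕ) {g : (ℕ → X) → X → ℝ} (hg : Measurable (Function.uncurry g))
    (hdep : DependsOn g (Set.Iic n)) (C : ℝ) (hC : ∀ τ y, |g τ y| ≤ C) :
    ∫ τ, g τ (τ (n + 1)) ∂(chainLaw μ₀ κ) = ∫ τ, ∫ y, g τ y ∂(κ (τ n)) ∂(chainLaw μ₀ κ) := by
  -- `e` extends a history to a full trajectory, so that `g` becomes a function of the history.
  let e : ((i : Finset.Iic n) → X) → ℕ → X := fun x k =>
    x ⟨min k n, Finset.mem_Iic.2 (min_le_right k n)⟩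
  have he : Measurable e := measurable_pi_iff.2 fun k => measurable_pi_apply _
  have hge : ∀ τ, g (e (Preorder.frestrictLe (π := fun _ : ℕ => X) n τ)) = g τ := fun τ =>
    hdep fun k hk => by
      simp only [Set.mem_Iic] at hk
      simp [e, min_eq_left hk]
  let κn : Kernel ((i : Finset.Iic n) → X) X :=
    κ.comap (fun x => x ⟨n, Finset.mem_Iic.2 le_rfl⟩) (measurable_pi_apply _)
  have hG : Measurable fun p : ((i : Finset.Iic n) → X) × X => g (e p.1) p.2 :=
    hg.comp ((he.comp measurable_fst).prodMk measurable_snd)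
  have hpair : Measurable fun τ : ℕ → X =>
      (Preorder.frestrictLe (π := fun _ : ℕ => X) n τ, τ (n + 1)) := by fun_prop
  have hM := Kernel.map_frestrictLe_trajMeasure_compProd_eq_map_trajMeasure
    (X := fun _ : ℕ => X) (μ₀ := μ₀) (κ := fun n =>
    κ.comap (fun x : (i : Finset.Iic n) → X => x ⟨n, Finset.mem_Iic.2 le_rfl⟩)
      (measurable_pi_apply _)) (a := n)
  change (chainLaw μ₀ κ).map _ ⊗ₘ κn = (chainLaw μ₀ κ).map _ at hM
  have hprob : IsProbabilityMeasure
      ((chainLaw μ₀ κ).map (Preorder.frestrictLe (π := fun _ : ℕ => X) n)) :=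
    Measure.isProbabilityMeasure_map (by fun_prop)
  have hinner : Measurable fun x => ∫ y, g (e x) y ∂(κn x) :=
    (StronglyMeasurable.integral_kernel_prod_right (κ := κn) (f := fun x y => g (e x) y)
      hG.stronglyMeasurable).measurable
  calc ∫ τ, g τ (τ (n + 1)) ∂(chainLaw μ₀ κ)
      = ∫ τ, g (e (Preorder.frestrictLe (π := fun _ : ℕ => X) n τ)) (τ (n + 1))
          ∂(chainLaw μ₀ κ) := by simp only [hge]
    _ = ∫ p, g (e p.1) p.2 ∂((chainLaw μ₀ κ).map fun τ : ℕ → X =>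
          (Preorder.frestrictLe (π := fun _ : ℕ => X) n τ, τ (n + 1))) :=
        (integral_map hpair.aemeasurable hG.aestronglyMeasurable).symm
    _ = ∫ x, ∫ y, g (e x) y ∂(κn x)
          ∂((chainLaw μ₀ κ).map (Preorder.frestrictLe (π := fun _ : ℕ => X) n)) := by
        rw [← hM, Measure.integral_compProd (integrable_of_abs_le hG C fun p => hC _ _)]
    _ = ∫ τ, ∫ y, g τ y ∂(κ (τ n)) ∂(chainLaw μ₀ κ) := by
        rw [integral_map (by fun_prop) hinner.aestronglyMeasurable]
        simp only [hge]
        rfl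

end Chain

/-! ### Change of measure and additive functionals along a Markov chain -/

section ChangeOfMeasure

section Path

variable {X : Type*}

/-- The product `∏_{k ≤ n} w(τ_k)` of one-step likelihood ratios. -/
def pathProd (w : X → ℝ) (n : ℕ) (τ : ℕ → X) : ℝ := ∏ k ∈ Finset.range (n + 1), w (τ k)

/-- The additive functional `∑_{k ≤ n} s(τ_k)`. -/
def pathSum (s : X → ℝ) (n : ℕ) (τ : ℕ → X) : ℝ := ∑ k ∈ Finset.range (n + 1), s (τ k)

lemma pathProd_succ (w : X → ℝ) (n : ℕ) (τ : ℕ → X) :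
    pathProd w (n + 1) τ = pathProd w n τ * w (τ (n + 1)) := Finset.prod_range_succ _ _

lemma pathSum_succ (s : X → ℝ) (n : ℕ) (τ : ℕ → X) :
    pathSum s (n + 1) τ = pathSum s n τ + s (τ (n + 1)) := Finset.sum_range_succ _ _

lemma pathProd_congr (w : X → ℝ) {n : ℕ} {τ τ' : ℕ → X} (h : ∀ k ∈ Set.Iic n, τ k = τ' k) :
    pathProd w n τ = pathProd w n τ' :=
  Finset.prod_congr rfl fun k hk => by
    rw [h k (Nat.lt_succ_iff.1 (Finset.mem_range.1 hk))]

lemma pathSum_congr (s : X → ℝ) {n : ℕ} {τ τ' : ℕ → X} (h : ∀ k ∈ Set.Iic n, τ k = τ' k) :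
    pathSum s n τ = pathSum s n τ' :=
  Finset.sum_congr rfl fun k hk => by
    rw [h k (Nat.lt_succ_iff.1 (Finset.mem_range.1 hk))]

lemma pathProd_nonneg {w : X → ℝ} (hw : ∀ x, 0 ≤ w x) (n : ℕ) (τ : ℕ → X) :
    0 ≤ pathProd w n τ := Finset.prod_nonneg fun _ _ => hw _

lemma pathProd_le {w : X → ℝ} {B : ℝ} (hw : ∀ x, 0 ≤ w x) (hB : ∀ x, w x ≤ B) (n : ℕ)
    (τ : ℕ → X) : pathProd w n τ ≤ B ^ (n + 1) := by
  simpa [pathProd] using Finset.prod_le_prod (s := Finset.range (n + 1)) (fun k _ => hw (τ k))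
    (fun k _ => hB (τ k))

lemma abs_pathSum_le {s : X → ℝ} {a : ℝ} (hs : ∀ x, |s x| ≤ a) (n : ℕ) (τ : ℕ → X) :
    |pathSum s n τ| ≤ (n + 1) * a := by
  refine (Finset.abs_sum_le_sum_abs _ _).trans ?_
  simpa using Finset.sum_le_sum (s := Finset.range (n + 1)) (fun k _ => hs (τ k))

lemma pathProd_exp (c : X → ℝ) (n : ℕ) (τ : ℕ → X) :
    pathProd (fun x => Real.exp (c x)) n τ = Real.exp (pathSum c n τ) :=
  (Real.exp_sum _ _).symm

variable [MeasurableSpace X]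

lemma measurable_pathProd {w : X → ℝ} (hw : Measurable w) (n : ℕ) : Measurable (pathProd w n) :=
  Finset.measurable_fun_prod _ fun k _ => hw.comp (measurable_pi_apply k)

lemma measurable_pathSum {s : X → ℝ} (hs : Measurable s) (n : ℕ) : Measurable (pathSum s n) :=
  Finset.measurable_fun_sum _ fun k _ => hs.comp (measurable_pi_apply k)

end Path

variable {X : Type*} [MeasurableSpace X]
variable (μ₀ : Measure X) [IsProbabilityMeasure μ₀] (κ : Kernel X X) [IsMarkovKernel κ]

/-- The path-wise product of one-step likelihood ratios is the likelihood ratio of two Markov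
chains, here tested on functions of the last coordinate. -/
lemma integral_chainLaw_change (μ₀' : Measure X) [IsProbabilityMeasure μ₀'] (κ' : Kernel X X)
    [IsMarkovKernel κ'] {w : X → ℝ} (hw : Measurable w) (hw0 : ∀ x, 0 ≤ w x) {B : ℝ}
    (hwB : ∀ x, w x ≤ B)
    (hμ : ∀ f : X → ℝ, Measurable f → (∃ C, ∀ x, |f x| ≤ C) →
      ∫ x, f x ∂μ₀' = ∫ x, w x * f x ∂μ₀)
    (hκ : ∀ z, ∀ f : X → ℝ, Measurable f → (∃ C, ∀ x, |f x| ≤ C) →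
      ∫ x, f x ∂(κ' z) = ∫ x, w x * f x ∂(κ z))
    (n : ℕ) {f : X → ℝ} (hf : Measurable f) {C : ℝ} (hC : ∀ x, |f x| ≤ C) :
    ∫ τ, f (τ n) ∂(chainLaw μ₀' κ') = ∫ τ, pathProd w n τ * f (τ n) ∂(chainLaw μ₀ κ) := by
  induction n generalizing f C with
  | zero =>
    simp only [pathProd, zero_add, Finset.prod_range_one]
    rw [integral_chainLaw_zero _ _ hf,
      integral_chainLaw_zero _ _ (f := fun x => w x * f x) (hw.mul hf), hμ f hf ⟨C, hC⟩]
  | succ n ih =>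
    have hm : Measurable fun z => ∫ y, f y ∂(κ' z) :=
      (hf.stronglyMeasurable.integral_kernel (κ := κ')).measurable
    have hb : ∀ z, |∫ y, f y ∂(κ' z)| ≤ C := fun z => by
      simpa using norm_integral_le_of_norm_le_const (μ := κ' z) (f := f)
        (Filter.Eventually.of_forall hC)
    rw [integral_chainLaw_succ μ₀' κ' n (g := fun _ y => f y) (hf.comp measurable_snd)
      (fun _ _ _ => rfl) C (fun _ => hC), ih hm hb]
    simp only [pathProd_succ, mul_assoc]
    rw [integral_chainLaw_succ μ₀ κ n (g := fun τ y => pathProd w n τ * (w y * f y))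
      (((measurable_pathProd hw n).comp measurable_fst).mul ((hw.mul hf).comp measurable_snd))
      (fun τ τ' h => by simp only [pathProd_congr w h]) (B ^ (n + 1) * (B * C))]
    · refine integral_congr_ae (Filter.Eventually.of_forall fun τ => ?_)
      simp only [integral_const_mul]
      rw [hκ _ f hf ⟨C, hC⟩]
    · intro τ y
      have hB : 0 ≤ B := (hw0 y).trans (hwB y)
      rw [abs_mul, abs_mul, abs_of_nonneg (pathProd_nonneg hw0 n τ), abs_of_nonneg (hw0 y)]
      exact mul_le_mul (pathProd_le hw0 hwB n τ)
        (mul_le_mul (hwB y) (hC y) (abs_nonneg _) hB)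
        (mul_nonneg (hw0 y) (abs_nonneg _)) (pow_nonneg hB _)

section Moments

variable {w s : X → ℝ} (hw : Measurable w) (hw0 : ∀ x, 0 ≤ w x) {B : ℝ} (hwB : ∀ x, w x ≤ B)

include hw hw0 hwB in
lemma integral_pathProd (hμ : ∫ x, w x ∂μ₀ = 1) (hκ : ∀ z, ∫ x, w x ∂(κ z) = 1) (n : ℕ) :
    ∫ τ, pathProd w n τ ∂(chainLaw μ₀ κ) = 1 := by
  induction n with
  | zero =>
    simp only [pathProd, zero_add, Finset.prod_range_one]
    rw [integral_chainLaw_zero _ _ hw, hμ]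
  | succ n ih =>
    simp only [pathProd_succ]
    rw [integral_chainLaw_succ μ₀ κ n (g := fun τ y => pathProd w n τ * w y)
      (((measurable_pathProd hw n).comp measurable_fst).mul (hw.comp measurable_snd))
      (fun τ τ' h => by simp only [pathProd_congr w h]) (B ^ (n + 1) * B)]
    · simp only [integral_const_mul, hκ, mul_one, ih]
    · intro τ y
      rw [abs_mul, abs_of_nonneg (pathProd_nonneg hw0 n τ), abs_of_nonneg (hw0 y)]
      exact mul_le_mul (pathProd_le hw0 hwB n τ) (hwB y) (hw0 y)
        (pow_nonneg ((hw0 y).trans (hwB y)) _)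

include hw hw0 hwB in
/-- Second moment of an additive functional with centred increments under the tilted chain: the
cross terms vanish, so the bound is linear, not quadratic, in the number of steps. -/
lemma integral_pathProd_mul_pathSum_sq_le (hs : Measurable s) {a : ℝ} (ha : ∀ x, |s x| ≤ a)
    (hμ : ∫ x, w x ∂μ₀ = 1) (hκ : ∀ z, ∫ x, w x ∂(κ z) = 1)
    (hsκ : ∀ z, ∫ x, w x * s x ∂(κ z) = 0) (n : ℕ) :
    ∫ τ, pathProd w n τ * pathSum s n τ ^ 2 ∂(chainLaw μ₀ κ) ≤ (n + 1) * a ^ 2 := by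
  have hws : ∀ m : Measure X, IsProbabilityMeasure m → ∫ x, w x ∂m = 1 →
      ∫ x, w x * s x ^ 2 ∂m ≤ a ^ 2 := by
    intro m _ h1
    calc ∫ x, w x * s x ^ 2 ∂m ≤ ∫ x, w x * a ^ 2 ∂m := by
          refine integral_mono_of_nonneg
            (Filter.Eventually.of_forall fun x => mul_nonneg (hw0 x) (sq_nonneg _))
            ((integrable_of_abs_le hw B fun x => by
              rw [abs_of_nonneg (hw0 x)]; exact hwB x).mul_const _)
            (Filter.Eventually.of_forall fun x => ?_)
          exact mul_le_mul_of_nonneg_left (sq_le_sq.2 ((ha x).trans (le_abs_self a))) (hw0 x)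
      _ = a ^ 2 := by rw [integral_mul_const, h1, one_mul]
  induction n with
  | zero =>
    simp only [pathProd, pathSum, zero_add, Finset.prod_range_one, Finset.sum_range_one]
    rw [integral_chainLaw_zero μ₀ κ (f := fun x => w x * s x ^ 2) (hw.mul (hs.pow_const 2))]
    simpa using hws μ₀ inferInstance hμ
  | succ n ih =>
    have hB1 : ∀ τ, |pathProd w n τ| ≤ B ^ (n + 1) := fun τ => by
      rw [abs_of_nonneg (pathProd_nonneg hw0 n τ)]; exact pathProd_le hw0 hwB n τ
    have hS2 : ∀ τ, |pathSum s n τ ^ 2| ≤ ((n + 1) * a) ^ 2 := fun τ => by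
      rw [abs_pow]; exact pow_le_pow_left₀ (abs_nonneg _) (abs_pathSum_le ha n τ) 2
    have hmW := measurable_pathProd hw n
    have hmS := measurable_pathSum hs n
    have hint : Integrable (fun τ => pathProd w n τ) (chainLaw μ₀ κ) :=
      integrable_of_abs_le hmW _ hB1
    have hint2 : Integrable (fun τ => pathProd w n τ * pathSum s n τ ^ 2) (chainLaw μ₀ κ) :=
      integrable_of_abs_le (hmW.mul (hmS.pow_const 2)) (B ^ (n + 1) * ((n + 1) * a) ^ 2)
        fun τ => by
          rw [abs_mul]
          exact mul_le_mul (hB1 τ) (hS2 τ) (abs_nonneg _) ((abs_nonneg _).trans (hB1 τ))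
    have hg : Measurable fun p : (ℕ → X) × X =>
        pathProd w n p.1 * w p.2 * (pathSum s n p.1 + s p.2) ^ 2 := by fun_prop
    simp only [pathProd_succ, pathSum_succ]
    rw [integral_chainLaw_succ μ₀ κ n
      (g := fun τ y => pathProd w n τ * w y * (pathSum s n τ + s y) ^ 2) hg
      (fun τ τ' h => by simp only [pathProd_congr w h, pathSum_congr s h])
      (B ^ (n + 1) * B * ((n + 1) * a + a) ^ 2)]
    · calc ∫ τ, ∫ y, pathProd w n τ * w y * (pathSum s n τ + s y) ^ 2 ∂(κ (τ n)) ∂(chainLaw μ₀ κ)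
          ≤ ∫ τ, (pathProd w n τ * pathSum s n τ ^ 2 + pathProd w n τ * a ^ 2)
              ∂(chainLaw μ₀ κ) := by
            refine integral_mono_of_nonneg
              (Filter.Eventually.of_forall fun τ => integral_nonneg fun y => ?_)
              (hint2.add (hint.mul_const _)) (Filter.Eventually.of_forall fun τ => ?_)
            · exact mul_nonneg (mul_nonneg (pathProd_nonneg hw0 n τ) (hw0 y)) (sq_nonneg _)
            · have i1 : Integrable w (κ (τ n)) := integrable_of_abs_le hw B fun x => by
                rw [abs_of_nonneg (hw0 x)]; exact hwB x
              have i2 : Integrable (fun y => w y * s y) (κ (τ n)) :=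
                integrable_of_abs_le (hw.mul hs) (B * a) fun x => by
                  rw [abs_mul, abs_of_nonneg (hw0 x)]
                  exact mul_le_mul (hwB x) (ha x) (abs_nonneg _) ((hw0 x).trans (hwB x))
              have i3 : Integrable (fun y => w y * s y ^ 2) (κ (τ n)) :=
                integrable_of_abs_le (hw.mul (hs.pow_const 2)) (B * a ^ 2) fun x => by
                  rw [abs_mul, abs_of_nonneg (hw0 x), abs_pow]
                  exact mul_le_mul (hwB x) (pow_le_pow_left₀ (abs_nonneg _) (ha x) 2)
                    (by positivity) ((hw0 x).trans (hwB x))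
              have i12 : Integrable
                  (fun y => pathSum s n τ ^ 2 * w y + 2 * pathSum s n τ * (w y * s y))
                  (κ (τ n)) := (i1.const_mul _).add (i2.const_mul _)
              have : ∀ y, pathProd w n τ * w y * (pathSum s n τ + s y) ^ 2 =
                  pathProd w n τ * (pathSum s n τ ^ 2 * w y + 2 * pathSum s n τ * (w y * s y)
                    + w y * s y ^ 2) := fun y => by ring
              simp only [this]
              rw [integral_const_mul, integral_add i12 i3,
                integral_add (i1.const_mul _) (i2.const_mul _), integral_const_mul,
                integral_const_mul, hκ, hsκ, ← mul_add]
              refine mul_le_mul_of_nonneg_left ?_ (pathProd_nonneg hw0 n τ)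
              linarith [hws (κ (τ n)) inferInstance (hκ _)]
        _ = (∫ τ, pathProd w n τ * pathSum s n τ ^ 2 ∂(chainLaw μ₀ κ)) + a ^ 2 := by
            rw [integral_add hint2 (hint.mul_const _), integral_mul_const,
              integral_pathProd μ₀ κ hw hw0 hwB hμ hκ, one_mul]
        _ ≤ _ := by push_cast; linarith
    · intro τ y
      have hS : |pathSum s n τ + s y| ≤ (n + 1) * a + a :=
        (abs_add_le _ _).trans (add_le_add (abs_pathSum_le ha n τ) (ha y))
      have hB : 0 ≤ B := (hw0 y).trans (hwB y)
      rw [abs_mul, abs_mul, abs_pow, abs_of_nonneg (hw0 y)]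
      exact mul_le_mul (mul_le_mul (hB1 τ) (hwB y) (hw0 y) (pow_nonneg hB _))
        (pow_le_pow_left₀ (abs_nonneg _) hS 2) (by positivity) (by positivity)

end Moments

end ChangeOfMeasure

/-! ### Second-order expansion of expectations under an exponential path of likelihood ratios -/

section LikelihoodPath

variable {X : Type*} [MeasurableSpace X]

/-- A one-parameter family `exp (c t)` of likelihood ratios, normalised with respect to the initial
distribution and to every transition, with `c 0 = 0`; `c'` and `c''` are the first two derivatives
of `c` in `t`, bounded by `a` and `b`. -/
structure LikelihoodPath (μ₀ : Measure X) (κ : Kernel X X) (c c' c'' : ℝ → X → ℝ) (a b : ℝ) :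
    Prop where
  measurable : ∀ t, Measurable (c t)
  zero : ∀ x, c 0 x = 0
  hasDerivAt : ∀ t x, HasDerivAt (fun s => c s x) (c' t x) t
  hasDerivAt' : ∀ t x, HasDerivAt (fun s => c' s x) (c'' t x) t
  a_nonneg : 0 ≤ a
  b_nonneg : 0 ≤ b
  abs_le' : ∀ t x, |c' t x| ≤ a
  abs_le'' : ∀ t x, |c'' t x| ≤ b
  init : ∀ t, ∫ x, Real.exp (c t x) ∂μ₀ = 1
  step : ∀ t z, ∫ x, Real.exp (c t x) ∂(κ z) = 1

namespace LikelihoodPath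

variable {μ₀ : Measure X} {κ : Kernel X X} {c c' c'' : ℝ → X → ℝ} {a b : ℝ}

lemma measurable' (h : LikelihoodPath μ₀ κ c c' c'' a b) (t : ℝ) : Measurable (c' t) :=
  measurable_of_hasDerivAt h.measurable (h.hasDerivAt t)

lemma abs_path_le (h : LikelihoodPath μ₀ κ c c' c'' a b) (t : ℝ) (x : X) : |c t x| ≤ a * |t| := by
  have := (convex_univ : Convex ℝ (Set.univ : Set ℝ)).norm_image_sub_le_of_norm_hasDerivWithin_le
    (fun s _ => (h.hasDerivAt s x).hasDerivWithinAt) (fun s _ => h.abs_le' s x) (Set.mem_univ 0)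
    (Set.mem_univ t)
  simpa [h.zero] using this

lemma exp_le (h : LikelihoodPath μ₀ κ c c' c'' a b) (t : ℝ) (x : X) :
    Real.exp (c t x) ≤ Real.exp (a * |t|) :=
  Real.exp_le_exp.2 ((le_abs_self _).trans (h.abs_path_le t x))

/-- The score of a normalised family is centred: differentiate `∫ exp (c t) = 1`. -/
lemma integral_score (h : LikelihoodPath μ₀ κ c c' c'' a b) {m : Measure X} [IsProbabilityMeasure m]
    (hm : ∀ t, ∫ x, Real.exp (c t x) ∂m = 1) (t : ℝ) :
    ∫ x, Real.exp (c t x) * c' t x ∂m = 0 := by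
  have hd := hasDerivAt_integral_of_bounded m (F := fun t x => Real.exp (c t x))
    (F' := fun t x => Real.exp (c t x) * c' t x) (fun t => (h.measurable t).exp)
    (fun t x => (h.hasDerivAt t x).exp) t (B := Real.exp (a * |t|))
    (C := Real.exp (a * (|t| + 1)) * a)
    (fun x => by rw [abs_of_pos (Real.exp_pos _)]; exact h.exp_le t x)
    (fun s hs x => by
      rw [abs_mul, abs_of_pos (Real.exp_pos _)]
      refine mul_le_mul ((h.exp_le s x).trans (Real.exp_le_exp.2 ?_)) (h.abs_le' s x)
        (abs_nonneg _) (Real.exp_pos _).le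
      have : |s| ≤ |t| + 1 := by
        have h1 := abs_sub_abs_le_abs_sub s t
        rw [Metric.mem_ball, Real.dist_eq] at hs
        linarith
      exact mul_le_mul_of_nonneg_left this h.a_nonneg)
  simp only [hm] at hd
  exact hd.unique (hasDerivAt_const t 1)

variable [IsProbabilityMeasure μ₀] [IsMarkovKernel κ]

/-- The linear term of the expansion is of order `√(n + 1)`, as the score along the chain is a sum
of `n + 1` centred increments. -/
lemma abs_first_order_le (h : LikelihoodPath μ₀ κ c c' c'' a b) {r : X → ℝ} (hr : Measurable r)
    (hr1 : ∀ x, |r x| ≤ 1) (n : ℕ) :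
    |∫ τ, r (τ n) * pathSum (c' 0) n τ ∂(chainLaw μ₀ κ)| ≤ √((n : ℝ) + 1) * a := by
  have hS := measurable_pathSum (h.measurable' 0) n
  have hrn : Measurable fun τ : ℕ → X => r (τ n) := hr.comp (measurable_pi_apply n)
  have hY : Measurable fun τ => r (τ n) * pathSum (c' 0) n τ := hrn.mul hS
  have hbS : ∀ τ, |pathSum (c' 0) n τ| ≤ (n + 1) * a := fun τ => abs_pathSum_le (h.abs_le' 0) n τ
  have hbY : ∀ τ, |r (τ n) * pathSum (c' 0) n τ| ≤ (n + 1) * a := fun τ => by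
    rw [abs_mul]
    exact (mul_le_of_le_one_left (abs_nonneg _) (hr1 _)).trans (hbS τ)
  have hvar := variance_nonneg (fun τ => r (τ n) * pathSum (c' 0) n τ) (chainLaw μ₀ κ)
  rw [variance_eq_sub (MemLp.of_bound hY.aestronglyMeasurable _
    (Filter.Eventually.of_forall hbY))] at hvar
  have hsq : ∫ τ, ((fun τ => r (τ n) * pathSum (c' 0) n τ) ^ 2) τ ∂(chainLaw μ₀ κ)
      ≤ (n + 1) * a ^ 2 := by
    have hm := integral_pathProd_mul_pathSum_sq_le μ₀ κ (w := fun _ => 1) (s := c' 0) (B := 1)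
      measurable_const (fun _ => zero_le_one) (fun _ => le_rfl) (h.measurable' 0) (h.abs_le' 0)
      (by simp) (by simp)
      (fun z => by simpa [h.zero] using h.integral_score (m := κ z) (fun t => h.step t z) 0) n
    refine le_trans (integral_mono_of_nonneg (Filter.Eventually.of_forall fun τ => ?_) ?_
      (Filter.Eventually.of_forall fun τ => ?_)) hm
    · exact sq_nonneg _
    · refine integrable_of_abs_le (by simpa [pathProd] using hS.pow_const 2)
        (((n + 1) * a) ^ 2) fun τ => ?_
      simpa [pathProd] using pow_le_pow_left₀ (abs_nonneg _) (hbS τ) 2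
    · simp only [Pi.pow_apply, mul_pow, pathProd, Finset.prod_const_one, one_mul]
      refine mul_le_of_le_one_left (sq_nonneg _) ?_
      rw [sq_le_one_iff_abs_le_one]
      exact hr1 _
  refine abs_le_of_sq_le_sq ?_ (mul_nonneg (Real.sqrt_nonneg _) h.a_nonneg)
  rw [mul_pow, Real.sq_sqrt (by positivity)]
  linarith

/-- Second-order expansion of `E[r(τ_n)]` along the path. The remainder is linear in `n`: the second
derivative is a tilted expectation of `S² + S'`, where `S` is a sum of centred increments. -/
lemma abs_second_order_le (h : LikelihoodPath μ₀ κ c c' c'' a b) {r : X → ℝ} (hr : Measurable r)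
    (hr1 : ∀ x, |r x| ≤ 1) (n : ℕ) :
    |(∫ τ, pathProd (fun x => Real.exp (c 1 x)) n τ * r (τ n) ∂(chainLaw μ₀ κ))
        - (∫ τ, r (τ n) ∂(chainLaw μ₀ κ))
        - ∫ τ, r (τ n) * pathSum (c' 0) n τ ∂(chainLaw μ₀ κ)| ≤ (n + 1) * (a ^ 2 + b) / 2 := by
  have ha := h.a_nonneg
  have hb := h.b_nonneg
  set F : ℝ → (ℕ → X) → ℝ := fun t τ => Real.exp (pathSum (c t) n τ) * r (τ n) with hFdef
  set F' : ℝ → (ℕ → X) → ℝ := fun t τ =>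
    Real.exp (pathSum (c t) n τ) * pathSum (c' t) n τ * r (τ n) with hF'def
  set F'' : ℝ → (ℕ → X) → ℝ := fun t τ =>
    (Real.exp (pathSum (c t) n τ) * pathSum (c' t) n τ * pathSum (c' t) n τ +
      Real.exp (pathSum (c t) n τ) * pathSum (c'' t) n τ) * r (τ n) with hF''def
  have hrn : Measurable fun τ : ℕ → X => r (τ n) := hr.comp (measurable_pi_apply n)
  have hm0 : ∀ t, Measurable (pathSum (c t) n) := fun t => measurable_pathSum (h.measurable t) n
  have hm1 : ∀ t, Measurable (pathSum (c' t) n) := fun t => measurable_pathSum (h.measurable' t) n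
  have hFm : ∀ t, Measurable (F t) := fun t => (hm0 t).exp.mul hrn
  have hF'm : ∀ t, Measurable (F' t) := fun t => ((hm0 t).exp.mul (hm1 t)).mul hrn
  have hds : ∀ t τ, HasDerivAt (fun s => pathSum (c s) n τ) (pathSum (c' t) n τ) t := fun t τ =>
    HasDerivAt.fun_sum fun k _ => h.hasDerivAt t (τ k)
  have hds' : ∀ t τ, HasDerivAt (fun s => pathSum (c' s) n τ) (pathSum (c'' t) n τ) t := fun t τ =>
    HasDerivAt.fun_sum fun k _ => h.hasDerivAt' t (τ k)
  have hd1 : ∀ t τ, HasDerivAt (fun s => F s τ) (F' t τ) t := fun t τ =>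
    (hds t τ).exp.mul_const _
  have hd2 : ∀ t τ, HasDerivAt (fun s => F' s τ) (F'' t τ) t := fun t τ =>
    ((hds t τ).exp.mul (hds' t τ)).mul_const _
  have hb1 : ∀ t τ, |pathSum (c' t) n τ| ≤ (n + 1) * a := fun t τ =>
    abs_pathSum_le (h.abs_le' t) n τ
  have hb2 : ∀ t τ, |pathSum (c'' t) n τ| ≤ (n + 1) * b := fun t τ =>
    abs_pathSum_le (h.abs_le'' t) n τ
  have hE : ∀ t s, |s| ≤ |t| + 1 → ∀ τ, Real.exp (pathSum (c s) n τ) ≤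
      Real.exp ((n + 1) * (a * (|t| + 1))) := fun t s hs τ => by
    refine Real.exp_le_exp.2 ((le_abs_self _).trans
      ((abs_pathSum_le (h.abs_path_le s) n τ).trans ?_))
    gcongr
  have hball : ∀ t : ℝ, ∀ s ∈ Metric.ball t 1, |s| ≤ |t| + 1 := fun t s hs => by
    have h1 := abs_sub_abs_le_abs_sub s t
    rw [Metric.mem_ball, Real.dist_eq] at hs
    linarith
  have hself : ∀ t : ℝ, |t| ≤ |t| + 1 := fun t => by linarith
  have hr0 : ∀ (y : ℝ) (τ : ℕ → X), |y * r (τ n)| ≤ |y| := fun y τ => by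
    rw [abs_mul]; exact mul_le_of_le_one_right (abs_nonneg _) (hr1 _)
  have hFb : ∀ t s, |s| ≤ |t| + 1 → ∀ τ, |F s τ| ≤ Real.exp ((n + 1) * (a * (|t| + 1))) :=
    fun t s hs τ => (hr0 _ τ).trans (by rw [abs_of_pos (Real.exp_pos _)]; exact hE t s hs τ)
  have hF'b : ∀ t s, |s| ≤ |t| + 1 → ∀ τ,
      |F' s τ| ≤ Real.exp ((n + 1) * (a * (|t| + 1))) * ((n + 1) * a) := fun t s hs τ => by
    refine (hr0 _ τ).trans ?_
    rw [abs_mul, abs_of_pos (Real.exp_pos _)]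
    exact mul_le_mul (hE t s hs τ) (hb1 s τ) (abs_nonneg _) (Real.exp_pos _).le
  have hF''b : ∀ t s, |s| ≤ |t| + 1 → ∀ τ,
      |F'' s τ| ≤ Real.exp ((n + 1) * (a * (|t| + 1))) * ((n + 1) * a) * ((n + 1) * a) +
        Real.exp ((n + 1) * (a * (|t| + 1))) * ((n + 1) * b) := fun t s hs τ => by
    refine (hr0 _ τ).trans ((abs_add_le _ _).trans ?_)
    rw [abs_mul, abs_mul, abs_mul, abs_of_pos (Real.exp_pos _)]
    have := hE t s hs τ
    have := hb1 s τ
    have := hb2 s τ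
    gcongr
  have hD1 : ∀ t, HasDerivAt (fun s => ∫ τ, F s τ ∂(chainLaw μ₀ κ))
      (∫ τ, F' t τ ∂(chainLaw μ₀ κ)) t := fun t =>
    hasDerivAt_integral_of_bounded _ hFm hd1 t (hFb t t (hself t))
      fun s hs τ => hF'b t s (hball t s hs) τ
  have hD2 : ∀ t, HasDerivAt (fun s => ∫ τ, F' s τ ∂(chainLaw μ₀ κ))
      (∫ τ, F'' t τ ∂(chainLaw μ₀ κ)) t := fun t =>
    hasDerivAt_integral_of_bounded _ hF'm hd2 t (hF'b t t (hself t))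
      fun s hs τ => hF''b t s (hball t s hs) τ
  have hC : ∀ t, |∫ τ, F'' t τ ∂(chainLaw μ₀ κ)| ≤ (n + 1) * (a ^ 2 + b) := by
    intro t
    have hw : Measurable fun x => Real.exp (c t x) := (h.measurable t).exp
    have hw0 : ∀ x, 0 ≤ Real.exp (c t x) := fun x => (Real.exp_pos _).le
    have hW1 := integral_pathProd μ₀ κ hw hw0 (h.exp_le t) (h.init t) (h.step t) n
    have hW2 := integral_pathProd_mul_pathSum_sq_le μ₀ κ hw hw0 (h.exp_le t) (h.measurable' t)
      (h.abs_le' t) (h.init t) (h.step t)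
      (fun z => h.integral_score (m := κ z) (fun t => h.step t z) t) n
    simp only [pathProd_exp] at hW1 hW2
    have i1 : Integrable (fun τ => Real.exp (pathSum (c t) n τ)) (chainLaw μ₀ κ) :=
      integrable_of_abs_le (hm0 t).exp _ fun τ => by
        rw [abs_of_pos (Real.exp_pos _)]; exact hE t t (hself t) τ
    have i2 : Integrable (fun τ => Real.exp (pathSum (c t) n τ) * pathSum (c' t) n τ ^ 2)
        (chainLaw μ₀ κ) :=
      integrable_of_abs_le ((hm0 t).exp.mul ((hm1 t).pow_const 2))
        (Real.exp ((n + 1) * (a * (|t| + 1))) * ((n + 1) * a) ^ 2) fun τ => by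
        rw [abs_mul, abs_pow, abs_of_pos (Real.exp_pos _)]
        have := hE t t (hself t) τ
        have := hb1 t τ
        gcongr
    calc |∫ τ, F'' t τ ∂(chainLaw μ₀ κ)| ≤ ∫ τ, |F'' t τ| ∂(chainLaw μ₀ κ) :=
          abs_integral_le_integral_abs
      _ ≤ ∫ τ, (Real.exp (pathSum (c t) n τ) * pathSum (c' t) n τ ^ 2 +
            Real.exp (pathSum (c t) n τ) * ((n + 1) * b)) ∂(chainLaw μ₀ κ) := by
          refine integral_mono_of_nonneg (Filter.Eventually.of_forall fun τ => abs_nonneg _)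
            (i2.add (i1.mul_const _)) (Filter.Eventually.of_forall fun τ => ?_)
          refine (hr0 _ τ).trans ((abs_add_le _ _).trans (add_le_add (le_of_eq ?_) ?_))
          · rw [mul_assoc, ← sq, abs_of_nonneg (by positivity)]
          · rw [abs_mul, abs_of_pos (Real.exp_pos _)]
            exact mul_le_mul_of_nonneg_left (hb2 t τ) (Real.exp_pos _).le
      _ ≤ (n + 1) * (a ^ 2 + b) := by
          rw [integral_add i2 (i1.mul_const _), integral_mul_const, hW1]
          linarith
  have := abs_taylor_one_le hD1 hD2 hC
  have h0 : ∀ τ, pathSum (c 0) n τ = 0 := fun τ => Finset.sum_eq_zero fun k _ => h.zero _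
  simpa only [hFdef, hF'def, h0, Real.exp_zero, one_mul, pathProd_exp, mul_comm (pathSum _ _ _)]
    using this

end LikelihoodPath

end LikelihoodPath

/-! ### The policy chain along a line in parameter space -/

section PolicyChain

variable {d : ℕ} {S A : Type*} [MeasurableSpace S] [MeasurableSpace A] {ν : Measure A}

/-- `log π_{θ + tδ}(a | s) - log π_θ(a | s)`. -/
def PolicyClass.logRatio (pol : PolicyClass d S ν) (θ δ : Param d) (t : ℝ) (x : S × A) : ℝ :=
  pol.logDens x.1 x.2 (θ + t • δ) - pol.logDens x.1 x.2 θ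

/-- The directional score `⟨∇ log π_{θ + tδ}(a | s), δ⟩`. -/
def PolicyClass.dirScore (pol : PolicyClass d S ν) (θ δ : Param d) (t : ℝ) (x : S × A) : ℝ :=
  inner ℝ (pol.score (θ + t • δ) x.1 x.2) δ

/-- The second directional derivative `⟨∇² log π_{θ + tδ}(a | s) δ, δ⟩`. -/
def PolicyClass.dirHess (pol : PolicyClass d S ν) (θ δ : Param d) (t : ℝ) (x : S × A) : ℝ :=
  inner ℝ (fderiv ℝ (∇ (pol.logDens x.1 x.2)) (θ + t • δ) δ) δ

lemma PolicyClass.dens_mul_exp_logRatio (pol : PolicyClass d S ν) (θ δ : Param d) (t : ℝ)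
    (s : S) (a : A) :
    pol.dens θ s a * Real.exp (pol.logRatio θ δ t (s, a)) = pol.dens (θ + t • δ) s a := by
  rw [PolicyClass.logRatio, Real.exp_sub, PolicyClass.logDens, PolicyClass.logDens,
    Real.exp_log (pol.dens_pos _ _ _), Real.exp_log (pol.dens_pos _ _ _),
    mul_div_cancel₀ _ (pol.dens_pos _ _ _).ne']

lemma PolicyClass.measurable_logRatio (pol : PolicyClass d S ν) (θ δ : Param d) (t : ℝ) :
    Measurable (pol.logRatio θ δ t) :=
  (Real.measurable_log.comp (pol.measurable_dens _)).sub
    (Real.measurable_log.comp (pol.measurable_dens _))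

/-- The expected immediate reward of a state-action pair. Averaging the reward at time `h` over
`s^{h+1}` makes it a function of the pair at time `h`, so that only `h + 1` scores enter its
policy gradient. -/
def MDP.expReward (M : MDP S A) (x : S × A) : ℝ := ∫ s', M.r x.1 x.2 s' ∂(M.P x)

lemma MDP.measurable_expReward (M : MDP S A) : Measurable M.expReward := by
  have := M.markov
  have hm : Measurable fun p : (S × A) × S => M.r p.1.1 p.1.2 p.2 :=
    M.measurable_r.comp (by fun_prop : Measurable fun p : (S × A) × S => (p.1.1, p.1.2, p.2))
  exact (StronglyMeasurable.integral_kernel_prod_right (κ := M.P)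
    (f := fun x s' => M.r x.1 x.2 s') hm.stronglyMeasurable).measurable

lemma MDP.abs_expReward_le (M : MDP S A) (x : S × A) : |M.expReward x| ≤ 1 := by
  have := M.markov
  simpa [MDP.expReward] using norm_integral_le_of_norm_le_const (μ := M.P x)
    (f := fun s' => M.r x.1 x.2 s') (Filter.Eventually.of_forall fun s' => M.abs_r_le x.1 x.2 s')

lemma MDP.measurable_reward (M : MDP S A) (h : ℕ) :
    Measurable fun τ : Traj S A => M.reward τ h :=
  M.measurable_r.comp
    (by fun_prop : Measurable fun τ : Traj S A => ((τ h).1, (τ h).2, (τ (h + 1)).1))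

section Bounds

variable {pol : PolicyClass d S ν} {Mg Mh : ℝ}

lemma PolicyClass.LogDensityBounds.norm_score_le (hlog : pol.LogDensityBounds Mg Mh)
    (θ : Param d) (s : S) (a : A) : ‖pol.score θ s a‖ ≤ √Mg :=
  Real.le_sqrt_of_sq_le (hlog.norm_score_sq_le θ s a)

lemma hasDerivAt_line (θ δ : Param d) (t : ℝ) : HasDerivAt (fun s : ℝ => θ + s • δ) δ t := by
  simpa using ((hasDerivAt_id t).smul_const δ).const_add θ

lemma PolicyClass.LogDensityBounds.hasDerivAt_logRatio (hlog : pol.LogDensityBounds Mg Mh)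
    (θ δ : Param d) (t : ℝ) (x : S × A) :
    HasDerivAt (fun s => pol.logRatio θ δ s x) (pol.dirScore θ δ t x) t := by
  have h := ((hlog.differentiable x.1 x.2 (θ + t • δ)).hasFDerivAt.comp_hasDerivAt t
    (hasDerivAt_line θ δ t)).sub_const (pol.logDens x.1 x.2 θ)
  rw [← inner_gradient_left] at h
  exact h

lemma PolicyClass.LogDensityBounds.hasDerivAt_dirScore (hlog : pol.LogDensityBounds Mg Mh)
    (θ δ : Param d) (t : ℝ) (x : S × A) :
    HasDerivAt (fun s => pol.dirScore θ δ s x) (pol.dirHess θ δ t x) t := by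
  have h := ((hlog.differentiable_gradient x.1 x.2 (θ + t • δ)).hasFDerivAt.comp_hasDerivAt t
    (hasDerivAt_line θ δ t)).inner ℝ (hasDerivAt_const t δ)
  simpa [PolicyClass.dirScore, PolicyClass.dirHess, PolicyClass.score] using h

lemma PolicyClass.LogDensityBounds.abs_dirScore_le (hlog : pol.LogDensityBounds Mg Mh)
    (θ δ : Param d) (t : ℝ) (x : S × A) : |pol.dirScore θ δ t x| ≤ √Mg * ‖δ‖ :=
  (abs_real_inner_le_norm _ _).trans
    (mul_le_mul_of_nonneg_right (hlog.norm_score_le _ _ _) (norm_nonneg _))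

lemma PolicyClass.LogDensityBounds.abs_dirHess_le (hlog : pol.LogDensityBounds Mg Mh)
    (θ δ : Param d) (t : ℝ) (x : S × A) : |pol.dirHess θ δ t x| ≤ Mh * ‖δ‖ ^ 2 := by
  refine (abs_real_inner_le_norm _ _).trans ?_
  rw [sq, ← mul_assoc]
  exact mul_le_mul_of_nonneg_right ((ContinuousLinearMap.le_opNorm _ _).trans
    (mul_le_mul_of_nonneg_right (hlog.norm_hessian_le _ _ _) (norm_nonneg _))) (norm_nonneg _)

lemma PolicyClass.LogDensityBounds.exp_logRatio_le (hlog : pol.LogDensityBounds Mg Mh)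
    (θ δ : Param d) (t : ℝ) (x : S × A) :
    Real.exp (pol.logRatio θ δ t x) ≤ Real.exp (√Mg * ‖δ‖ * |t|) := by
  refine Real.exp_le_exp.2 ((le_abs_self _).trans ?_)
  have := (convex_univ : Convex ℝ (Set.univ : Set ℝ)).norm_image_sub_le_of_norm_hasDerivWithin_le
    (fun s _ => (hlog.hasDerivAt_logRatio θ δ s x).hasDerivWithinAt)
    (fun s _ => hlog.abs_dirScore_le θ δ s x) (Set.mem_univ 0) (Set.mem_univ t)
  simpa [PolicyClass.logRatio] using this

lemma PolicyClass.LogDensityBounds.measurable_score (hlog : pol.LogDensityBounds Mg Mh)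
    (θ : Param d) : Measurable fun x : S × A => pol.score θ x.1 x.2 := by
  have h : ∀ i : Fin d, Measurable fun x : S × A => pol.score θ x.1 x.2 i := fun i => by
    have := measurable_of_hasDerivAt (t := 0)
      (pol.measurable_logRatio θ (EuclideanSpace.single i 1))
      (hlog.hasDerivAt_logRatio θ (EuclideanSpace.single i 1) 0)
    have h' : pol.dirScore θ (EuclideanSpace.single i 1) 0 =
        fun x : S × A => pol.score θ x.1 x.2 i := by
      funext x
      simp [PolicyClass.dirScore, EuclideanSpace.inner_single_right]
    rwa [h'] at this
  exact (WithLp.measurable_toLp 2 (Fin d → ℝ)).comp (measurable_pi_iff.2 h)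

variable [SigmaFinite ν]

lemma PolicyClass.integral_kernel (pol : PolicyClass d S ν) (θ : Param d) (s : S) (f : A → ℝ) :
    ∫ a, f a ∂(pol.kernel θ s) = ∫ a, pol.dens θ s a * f a ∂ν := by
  have hm : Measurable (Function.uncurry fun s a => ENNReal.ofReal (pol.dens θ s a)) :=
    ENNReal.measurable_ofReal.comp (pol.measurable_dens θ)
  rw [PolicyClass.kernel, Kernel.withDensity_apply _ hm, Kernel.const_apply,
    integral_withDensity_eq_integral_toReal_smul
      (f := fun a => ENNReal.ofReal (pol.dens θ s a)) (hm.comp measurable_prodMk_left)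
      (Filter.Eventually.of_forall fun a => ENNReal.ofReal_lt_top)]
  simp only [ENNReal.toReal_ofReal (pol.dens_pos θ s _).le, smul_eq_mul]

lemma PolicyClass.integral_kernel_line (pol : PolicyClass d S ν) (θ δ : Param d) (t : ℝ) (s : S)
    (f : A → ℝ) : ∫ a, f a ∂(pol.kernel (θ + t • δ) s) =
      ∫ a, Real.exp (pol.logRatio θ δ t (s, a)) * f a ∂(pol.kernel θ s) := by
  simp only [pol.integral_kernel, ← mul_assoc, pol.dens_mul_exp_logRatio]

lemma MDP.integral_step (M : MDP S A) (pol : PolicyClass d S ν) (θ : Param d) (z : S × A)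
    {f : S × A → ℝ} (hf : Measurable f) {C : ℝ} (hC : ∀ x, |f x| ≤ C) :
    ∫ x, f x ∂(M.step pol θ z) = ∫ s, ∫ a, f (s, a) ∂(pol.kernel θ s) ∂(M.P z) := by
  have := M.markov
  have hi : Integrable f (M.step pol θ z) := integrable_of_abs_le hf C hC
  rw [MDP.step] at hi ⊢
  rw [integral_compProd hi]
  rfl

lemma PolicyClass.integral_init (pol : PolicyClass d S ν) (ρ : Measure S) [IsProbabilityMeasure ρ]
    (θ : Param d) {f : S × A → ℝ} (hf : Measurable f) {C : ℝ} (hC : ∀ x, |f x| ≤ C) :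
    ∫ x, f x ∂(ρ ⊗ₘ pol.kernel θ) = ∫ s, ∫ a, f (s, a) ∂(pol.kernel θ s) ∂ρ :=
  Measure.integral_compProd (integrable_of_abs_le hf C hC)

/-- Along a line in parameter space, the policies are an exponential path of likelihood ratios for
the state-action chain. -/
lemma PolicyClass.LogDensityBounds.likelihoodPath (hlog : pol.LogDensityBounds Mg Mh)
    (hMh : 0 ≤ Mh) (M : MDP S A) (ρ : Measure S) [IsProbabilityMeasure ρ] (θ δ : Param d) :
    LikelihoodPath (ρ ⊗ₘ pol.kernel θ) (M.step pol θ) (pol.logRatio θ δ) (pol.dirScore θ δ)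
      (pol.dirHess θ δ) (√Mg * ‖δ‖) (Mh * ‖δ‖ ^ 2) := by
  have hone : ∀ t s, ∫ a, Real.exp (pol.logRatio θ δ t (s, a)) ∂(pol.kernel θ s) = 1 := by
    intro t s
    have := pol.integral_kernel_line θ δ t s fun _ => 1
    simpa using this.symm
  have hb : ∀ t x, |Real.exp (pol.logRatio θ δ t x)| ≤ Real.exp (√Mg * ‖δ‖ * |t|) := fun t x => by
    rw [abs_of_pos (Real.exp_pos _)]; exact hlog.exp_logRatio_le θ δ t x
  have := M.markov
  exact
  { measurable := pol.measurable_logRatio θ δ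
    zero := fun x => by simp [PolicyClass.logRatio]
    hasDerivAt := hlog.hasDerivAt_logRatio θ δ
    hasDerivAt' := hlog.hasDerivAt_dirScore θ δ
    a_nonneg := by positivity
    b_nonneg := by positivity
    abs_le' := hlog.abs_dirScore_le θ δ
    abs_le'' := hlog.abs_dirHess_le θ δ
    init := fun t => by
      rw [pol.integral_init ρ θ (pol.measurable_logRatio θ δ t).exp (hb t)]
      simp [hone]
    step := fun t z => by
      rw [M.integral_step pol θ z (pol.measurable_logRatio θ δ t).exp (hb t)]
      simp [hone] }

/-! ### Expansion of the expected reward at a fixed time -/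

lemma MDP.trajLaw_eq_chainLaw (M : MDP S A) (pol : PolicyClass d S ν) (ρ : Measure S)
    (θ : Param d) : M.trajLaw pol ρ θ = chainLaw (ρ ⊗ₘ pol.kernel θ) (M.step pol θ) := rfl

instance (M : MDP S A) (pol : PolicyClass d S ν) (ρ : Measure S) [IsProbabilityMeasure ρ]
    (θ : Param d) : IsProbabilityMeasure (M.trajLaw pol ρ θ) := by
  rw [M.trajLaw_eq_chainLaw]; infer_instance

/-- The expected reward `E_{p_θ} r^h` at time `h`. -/
def MDP.meanReward (M : MDP S A) (pol : PolicyClass d S ν) (ρ : Measure S) (h : ℕ)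
    (θ : Param d) : ℝ := ∫ τ, M.reward τ h ∂(M.trajLaw pol ρ θ)

/-- The policy gradient `E_{p_θ}[r̄(s^h, a^h) ∑_{k ≤ h} ∇ log π_θ(a^k | s^k)]` of the expected
reward at time `h`, the reward being averaged over the next state. -/
def MDP.gradReward (M : MDP S A) (pol : PolicyClass d S ν) (ρ : Measure S) (h : ℕ)
    (θ : Param d) : Param d :=
  ∫ τ, M.expReward (τ h) • ∑ k ∈ Finset.range (h + 1), pol.score θ (τ k).1 (τ k).2
    ∂(M.trajLaw pol ρ θ)

variable (M : MDP S A) (ρ : Measure S) [IsProbabilityMeasure ρ]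

lemma MDP.meanReward_eq (pol : PolicyClass d S ν) (h : ℕ) (θ : Param d) :
    M.meanReward pol ρ h θ = ∫ τ, M.expReward (τ h) ∂(M.trajLaw pol ρ θ) := by
  have := M.markov
  have hm : Measurable fun p : (S × A) × (S × A) => M.r p.1.1 p.1.2 p.2.1 :=
    M.measurable_r.comp
      (by fun_prop : Measurable fun p : (S × A) × (S × A) => (p.1.1, p.1.2, p.2.1))
  have hg : Measurable fun p : (ℕ → S × A) × (S × A) => M.r (p.1 h).1 (p.1 h).2 p.2.1 :=
    hm.comp (by fun_prop : Measurable fun p : (ℕ → S × A) × (S × A) => (p.1 h, p.2))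
  rw [MDP.meanReward, M.trajLaw_eq_chainLaw]
  simp only [MDP.reward]
  refine (integral_chainLaw_succ (ρ ⊗ₘ pol.kernel θ) (M.step pol θ) h
    (g := fun (τ : ℕ → S × A) (y : S × A) => M.r (τ h).1 (τ h).2 y.1) hg
    (fun τ τ' hτ => by simp only [hτ h (Set.mem_Iic.2 le_rfl)]) 1
    (fun τ y => M.abs_r_le _ _ _)).trans ?_
  refine integral_congr_ae (Filter.Eventually.of_forall fun τ => ?_)
  simp only
  rw [M.integral_step pol θ (τ h) (f := fun y => M.r (τ h).1 (τ h).2 y.1)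
    (hm.comp (measurable_prodMk_left (x := τ h))) (fun y => M.abs_r_le _ _ _)]
  simp [MDP.expReward]

lemma PolicyClass.LogDensityBounds.inner_gradReward (hlog : pol.LogDensityBounds Mg Mh) (h : ℕ)
    (θ δ : Param d) : inner ℝ (M.gradReward pol ρ h θ) δ =
      ∫ τ, M.expReward (τ h) * pathSum (pol.dirScore θ δ 0) h τ ∂(M.trajLaw pol ρ θ) := by
  have hsum : Measurable fun τ : ℕ → S × A =>
      M.expReward (τ h) • ∑ k ∈ Finset.range (h + 1), pol.score θ (τ k).1 (τ k).2 :=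
    (M.measurable_expReward.comp (measurable_pi_apply h)).smul
      (Finset.measurable_fun_sum _ fun k _ =>
        (hlog.measurable_score θ).comp (measurable_pi_apply k))
  have hint : Integrable (fun τ : ℕ → S × A =>
      M.expReward (τ h) • ∑ k ∈ Finset.range (h + 1), pol.score θ (τ k).1 (τ k).2)
      (M.trajLaw pol ρ θ) := by
    refine Integrable.of_bound hsum.aestronglyMeasurable (((h + 1 : ℕ) : ℝ) * √Mg)
      (Filter.Eventually.of_forall fun τ => ?_)
    rw [norm_smul]
    refine (mul_le_of_le_one_left (norm_nonneg _) (M.abs_expReward_le _)).trans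
      ((norm_sum_le_of_le _ fun k _ => hlog.norm_score_le θ (τ k).1 (τ k).2).trans ?_)
    simp
  rw [MDP.gradReward, real_inner_comm, ← integral_inner hint]
  refine integral_congr_ae (Filter.Eventually.of_forall fun τ => ?_)
  simp only [inner_smul_right, inner_sum, pathSum, PolicyClass.dirScore, zero_smul, add_zero,
    real_inner_comm]

/-- Second-order expansion of the expected reward at time `h`, with remainder linear in `h`. -/
lemma PolicyClass.LogDensityBounds.abs_meanReward_sub_le (hlog : pol.LogDensityBounds Mg Mh)
    (hMg : 0 ≤ Mg) (hMh : 0 ≤ Mh) (h : ℕ) (θ δ : Param d) :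
    |M.meanReward pol ρ h (θ + δ) - M.meanReward pol ρ h θ - inner ℝ (M.gradReward pol ρ h θ) δ|
      ≤ ((h : ℝ) + 1) * (Mg + Mh) / 2 * ‖δ‖ ^ 2 := by
  have hp := hlog.likelihoodPath hMh M ρ θ δ
  have := M.markov
  have h2 := hp.abs_second_order_le M.measurable_expReward M.abs_expReward_le h
  have hwm : Measurable fun x => Real.exp (pol.logRatio θ δ 1 x) :=
    (pol.measurable_logRatio θ δ 1).exp
  have hb : ∀ f : S × A → ℝ, ∀ C, (∀ x, |f x| ≤ C) → ∀ x, |Real.exp (pol.logRatio θ δ 1 x) * f x| ≤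
      Real.exp (√Mg * ‖δ‖ * |1|) * C := fun f C hC x => by
    rw [abs_mul, abs_of_pos (Real.exp_pos _)]
    exact mul_le_mul (hlog.exp_logRatio_le θ δ 1 x) (hC x) (abs_nonneg _) (Real.exp_pos _).le
  have hchange := integral_chainLaw_change (ρ ⊗ₘ pol.kernel θ) (M.step pol θ)
    (ρ ⊗ₘ pol.kernel (θ + (1 : ℝ) • δ)) (M.step pol (θ + (1 : ℝ) • δ)) hwm
    (fun x => (Real.exp_pos _).le) (hlog.exp_logRatio_le θ δ 1)
    (fun f hf ⟨C, hC⟩ => by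
      rw [pol.integral_init ρ _ hf hC,
        pol.integral_init ρ θ (f := fun x => Real.exp (pol.logRatio θ δ 1 x) * f x) (hwm.mul hf)
          (hb f C hC)]
      simp only [pol.integral_kernel_line θ δ 1])
    (fun z f hf ⟨C, hC⟩ => by
      rw [M.integral_step pol _ z hf hC,
        M.integral_step pol θ z (f := fun x => Real.exp (pol.logRatio θ δ 1 x) * f x) (hwm.mul hf)
          (hb f C hC)]
      simp only [pol.integral_kernel_line θ δ 1])
    h M.measurable_expReward M.abs_expReward_le
  rw [one_smul] at hchange
  rw [M.meanReward_eq, M.meanReward_eq, hlog.inner_gradReward M ρ]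
  simp only [M.trajLaw_eq_chainLaw]
  rw [hchange]
  refine h2.trans (le_of_eq ?_)
  rw [mul_pow, Real.sq_sqrt hMg]
  ring

lemma PolicyClass.LogDensityBounds.norm_gradReward_le (hlog : pol.LogDensityBounds Mg Mh)
    (hMh : 0 ≤ Mh) (h : ℕ) (θ : Param d) :
    ‖M.gradReward pol ρ h θ‖ ≤ √((h : ℝ) + 1) * √Mg := by
  have := M.markov
  set G := M.gradReward pol ρ h θ with hG
  have h1 := (hlog.likelihoodPath hMh M ρ θ G).abs_first_order_le M.measurable_expReward
    M.abs_expReward_le h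
  rw [← M.trajLaw_eq_chainLaw, ← hlog.inner_gradReward M ρ, ← hG, real_inner_self_eq_norm_sq,
    abs_of_nonneg (sq_nonneg _), sq, ← mul_assoc] at h1
  rcases (norm_nonneg G).eq_or_lt with h0 | h0
  · rw [← h0]; positivity
  · exact le_of_mul_le_mul_right h1 h0

end Bounds

end PolicyChain

/-! ### Smoothness of the discounted objectives -/

section Objective

lemma hasGradientAt_of_quadratic_bound {E : Type*} [NormedAddCommGroup E] [InnerProductSpace ℝ E]
    [CompleteSpace E] {f : E → ℝ} {g x : E} {C : ℝ}
    (h : ∀ δ, |f (x + δ) - f x - inner ℝ g δ| ≤ C * ‖δ‖ ^ 2) : HasGradientAt f g x := by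
  rw [hasGradientAt_iff_isLittleO_nhds_zero]
  refine (Asymptotics.IsBigO.of_bound C (Filter.Eventually.of_forall fun δ => ?_)).trans_isLittleO
    (Asymptotics.isLittleO_norm_pow_id one_lt_two)
  simpa using h δ

variable {d : ℕ} {S A : Type*} [MeasurableSpace S] [MeasurableSpace A] {ν : Measure A}
  (M : MDP S A)

lemma MDP.hasSum_geometric : HasSum (fun h : ℕ => M.γ ^ h) (1 / (1 - M.γ)) := by
  simpa using hasSum_geometric_of_lt_one M.γ_nonneg M.γ_lt_one

lemma MDP.hasSum_geometric_mul (c : ℝ) :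
    HasSum (fun h : ℕ => M.γ ^ h * (h + 1 + c)) (1 / (1 - M.γ) * (1 / (1 - M.γ) + c)) := by
  have h1 : 1 - M.γ ≠ 0 := (sub_pos.2 M.γ_lt_one).ne'
  have h2 := (hasSum_coe_mul_geometric_of_norm_lt_one (𝕜 := ℝ) (r := M.γ)
    (by rw [Real.norm_of_nonneg M.γ_nonneg]; exact M.γ_lt_one)).add
    (M.hasSum_geometric.mul_right (1 + c))
  have e1 : (fun h : ℕ => M.γ ^ h * (h + 1 + c)) =
      fun h : ℕ => h * M.γ ^ h + M.γ ^ h * (1 + c) := by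
    funext h; ring
  have e2 : 1 / (1 - M.γ) * (1 / (1 - M.γ) + c) =
      M.γ / (1 - M.γ) ^ 2 + 1 / (1 - M.γ) * (1 + c) := by
    have e3 : M.γ / (1 - M.γ) ^ 2 = 1 / (1 - M.γ) * (1 / (1 - M.γ)) - 1 / (1 - M.γ) := by
      field_simp; ring
    rw [e3]; ring
  rw [e1, e2]
  exact h2

variable [SigmaFinite ν] (pol : PolicyClass d S ν) (ρ : Measure S) [IsProbabilityMeasure ρ]

lemma MDP.integrable_reward (h : ℕ) (θ : Param d) :
    Integrable (fun τ => M.γ ^ h * M.reward τ h) (M.trajLaw pol ρ θ) :=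
  (integrable_of_abs_le (M.measurable_reward h) 1 fun _ => M.abs_r_le _ _ _).const_mul _

lemma MDP.JH_eq (H : ℕ) (θ : Param d) :
    M.JH pol ρ H θ = ∑ h ∈ Finset.range H, M.γ ^ h * M.meanReward pol ρ h θ := by
  rw [MDP.JH, integral_finsetSum _ fun h _ => M.integrable_reward pol ρ h θ]
  simp only [integral_const_mul, MDP.meanReward]

lemma MDP.hasSum_J (θ : Param d) :
    HasSum (fun h => M.γ ^ h * M.meanReward pol ρ h θ) (M.J pol ρ θ) := by
  have hb : ∀ h, ∫ τ, ‖M.γ ^ h * M.reward τ h‖ ∂(M.trajLaw pol ρ θ) ≤ M.γ ^ h := fun h => by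
    have := norm_integral_le_of_norm_le_const (μ := M.trajLaw pol ρ θ) (C := M.γ ^ h)
      (f := fun τ => ‖M.γ ^ h * M.reward τ h‖) (Filter.Eventually.of_forall fun τ => by
        rw [norm_norm, norm_mul, Real.norm_of_nonneg (pow_nonneg M.γ_nonneg h)]
        exact mul_le_of_le_one_right (pow_nonneg M.γ_nonneg h) (M.abs_r_le _ _ _))
    exact (Real.le_norm_self _).trans (by simpa using this)
  have := hasSum_integral_of_summable_integral_norm (μ := M.trajLaw pol ρ θ)
    (F := fun h τ => M.γ ^ h * M.reward τ h) (fun h => M.integrable_reward pol ρ h θ)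
    (Summable.of_nonneg_of_le (fun h => integral_nonneg fun τ => norm_nonneg _) hb
      M.hasSum_geometric.summable)
  simp only [integral_const_mul] at this
  exact this

/-- The policy gradient `∑_h γ^h ∇ E_{p_θ} r^h`. -/
def MDP.gradJ (θ : Param d) : Param d := ∑' h, M.γ ^ h • M.gradReward pol ρ h θ

variable {pol} {Mg Mh : ℝ}

lemma PolicyClass.LogDensityBounds.norm_smul_gradReward_le (hlog : pol.LogDensityBounds Mg Mh)
    (hMh : 0 ≤ Mh) (h : ℕ) (θ : Param d) :
    ‖M.γ ^ h • M.gradReward pol ρ h θ‖ ≤ M.γ ^ h * (√((h : ℝ) + 1) * √Mg) := by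
  rw [norm_smul, Real.norm_of_nonneg (pow_nonneg M.γ_nonneg h)]
  exact mul_le_mul_of_nonneg_left (hlog.norm_gradReward_le M ρ hMh h θ) (pow_nonneg M.γ_nonneg h)

lemma PolicyClass.LogDensityBounds.summable_gradReward (hlog : pol.LogDensityBounds Mg Mh)
    (hMh : 0 ≤ Mh) (θ : Param d) : Summable fun h => M.γ ^ h • M.gradReward pol ρ h θ := by
  refine Summable.of_norm_bounded ((M.hasSum_geometric_mul 0).summable.mul_right √Mg) fun h => ?_
  refine (hlog.norm_smul_gradReward_le M ρ hMh h θ).trans ?_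
  rw [← mul_assoc, add_zero]
  have h1 : √((h : ℝ) + 1) ≤ h + 1 := by
    have h0 : (0 : ℝ) ≤ h := h.cast_nonneg
    exact Real.sqrt_le_iff.2 ⟨by linarith, by nlinarith⟩
  have := pow_nonneg M.γ_nonneg h
  gcongr

/-- `J_ρ` is `L`-smooth, with the gradient given by the policy gradient theorem. -/
lemma PolicyClass.LogDensityBounds.abs_J_sub_le (hlog : pol.LogDensityBounds Mg Mh)
    (hMg : 0 ≤ Mg) (hMh : 0 ≤ Mh) (θ δ : Param d) :
    |M.J pol ρ (θ + δ) - M.J pol ρ θ - inner ℝ (M.gradJ pol ρ θ) δ| ≤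
      M.L Mg Mh / 2 * ‖δ‖ ^ 2 := by
  have hG : HasSum (fun h => M.γ ^ h * inner ℝ (M.gradReward pol ρ h θ) δ)
      (inner ℝ (M.gradJ pol ρ θ) δ) := by
    have := ((innerSL ℝ δ : Param d →L[ℝ] ℝ).hasSum (hlog.summable_gradReward M ρ hMh θ).hasSum)
    simpa [real_inner_comm, inner_smul_right, MDP.gradJ] using this
  have hs := ((M.hasSum_J pol ρ (θ + δ)).sub (M.hasSum_J pol ρ θ)).sub hG
  have hB := (M.hasSum_geometric_mul 0).mul_right ((Mg + Mh) / 2 * ‖δ‖ ^ 2)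
  rw [← hs.tsum_eq, ← Real.norm_eq_abs]
  refine (tsum_of_norm_bounded hB fun h => ?_).trans (le_of_eq ?_)
  · rw [← mul_sub, ← mul_sub, norm_mul, Real.norm_of_nonneg (pow_nonneg M.γ_nonneg h),
      Real.norm_eq_abs, mul_assoc]
    refine mul_le_mul_of_nonneg_left ((hlog.abs_meanReward_sub_le M ρ hMg hMh h θ δ).trans
      (le_of_eq ?_)) (pow_nonneg M.γ_nonneg h)
    ring
  · rw [MDP.L, ← one_div_pow]
    ring

lemma PolicyClass.LogDensityBounds.hasGradientAt_J (hlog : pol.LogDensityBounds Mg Mh)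
    (hMg : 0 ≤ Mg) (hMh : 0 ≤ Mh) (θ : Param d) :
    HasGradientAt (M.J pol ρ) (M.gradJ pol ρ θ) θ :=
  hasGradientAt_of_quadratic_bound (hlog.abs_J_sub_le M ρ hMg hMh θ)

lemma PolicyClass.LogDensityBounds.hasGradientAt_JH (hlog : pol.LogDensityBounds Mg Mh)
    (hMg : 0 ≤ Mg) (hMh : 0 ≤ Mh) (H : ℕ) (θ : Param d) :
    HasGradientAt (M.JH pol ρ H) (∑ h ∈ Finset.range H, M.γ ^ h • M.gradReward pol ρ h θ) θ := by
  refine hasGradientAt_of_quadratic_bound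
    (C := ∑ h ∈ Finset.range H, M.γ ^ h * (((h : ℝ) + 1) * (Mg + Mh) / 2)) fun δ => ?_
  simp only [M.JH_eq, sum_inner, inner_smul_left, ← Finset.sum_sub_distrib, Finset.sum_mul]
  refine (Finset.abs_sum_le_sum_abs _ _).trans (Finset.sum_le_sum fun h _ => ?_)
  simp only [conj_trivial]
  rw [← mul_sub, ← mul_sub, abs_mul, abs_of_nonneg (pow_nonneg M.γ_nonneg h), mul_assoc (_ ^ h)]
  exact mul_le_mul_of_nonneg_left (hlog.abs_meanReward_sub_le M ρ hMg hMh h θ δ)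
    (pow_nonneg M.γ_nonneg h)

/-- Bias of the truncated gradient. -/
lemma PolicyClass.LogDensityBounds.norm_gradJ_sub_le (hlog : pol.LogDensityBounds Mg Mh)
    (hMh : 0 ≤ Mh) (H : ℕ) (θ : Param d) :
    ‖M.gradJ pol ρ θ - ∑ h ∈ Finset.range H, M.γ ^ h • M.gradReward pol ρ h θ‖ ≤
      M.Gg Mg H * M.γ ^ H := by
  have hγ : 0 < 1 - M.γ := sub_pos.2 M.γ_lt_one
  set l : ℝ := √(1 / (1 - M.γ) + H) with hl
  have hl2 : l ^ 2 = 1 / (1 - M.γ) + H := Real.sq_sqrt (by positivity)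
  have hl0 : 0 < l := Real.sqrt_pos.2 (by positivity)
  rw [MDP.gradJ, ← (hlog.summable_gradReward M ρ hMh θ).sum_add_tsum_nat_add H,
    add_sub_cancel_left]
  have hB := ((((M.hasSum_geometric_mul H).mul_right (1 / (2 * l))).add
    (M.hasSum_geometric.mul_right (l / 2))).mul_right (M.γ ^ H * √Mg))
  refine (tsum_of_norm_bounded hB fun h => ?_).trans (le_of_eq ?_)
  · -- By the arithmetic-geometric mean inequality, `√y ≤ (y / l + l) / 2`; the weight `l` makes the
    -- two resulting series equal.
    have hs : √(((h + H : ℕ) : ℝ) + 1) ≤ (h + 1 + H) * (1 / (2 * l)) + l / 2 := by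
      have hy : (0 : ℝ) ≤ h + 1 + H := by positivity
      have h1 := sq_nonneg (√((h : ℝ) + 1 + H) - l)
      have h2 := Real.sq_sqrt hy
      have h3 : ((h + H : ℕ) : ℝ) + 1 = h + 1 + H := by push_cast; ring
      rw [h3]
      have h4 : ((h : ℝ) + 1 + H) * (1 / (2 * l)) + l / 2 = (h + 1 + H + l ^ 2) / (2 * l) := by
        field_simp
      rw [h4, le_div_iff₀ (by positivity)]
      linarith
    refine (hlog.norm_smul_gradReward_le M ρ hMh (h + H) θ).trans ?_
    have e : (M.γ ^ h * (↑h + 1 + ↑H) * (1 / (2 * l)) + M.γ ^ h * (l / 2)) * (M.γ ^ H * √Mg) =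
        M.γ ^ (h + H) * (((h + 1 + H) * (1 / (2 * l)) + l / 2) * √Mg) := by
      rw [pow_add]; ring
    rw [e]
    exact mul_le_mul_of_nonneg_left (mul_le_mul_of_nonneg_right hs (Real.sqrt_nonneg _))
      (pow_nonneg M.γ_nonneg _)
  · rw [MDP.Gg, ← hl, ← hl2]
    field_simp
    ring

end Objective

/-! ### The Fisher information matrix -/

section Fisher

variable {d : ℕ} {S A : Type*} [MeasurableSpace S] [MeasurableSpace A] {ν : Measure A}
  [SigmaFinite ν] (M : MDP S A) (pol : PolicyClass d S ν) (ρ : Measure S)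

/-- `F(θ) v`, as a vector of `ℝ^d`. -/
def MDP.fisherMul (θ v : Param d) : Param d :=
  WithLp.toLp 2 (Matrix.mulVec (M.fisher pol ρ θ) v.ofLp)

lemma MDP.fisherMul_sub (θ v v' : Param d) :
    M.fisherMul pol ρ θ (v - v') = M.fisherMul pol ρ θ v - M.fisherMul pol ρ θ v' := by
  simp [MDP.fisherMul, Matrix.mulVec_sub]

section NonDegenerate

variable {M pol ρ} {μF : ℝ}

lemma MDP.FisherNonDegenerate.le_inner_fisherMul_self (hF : M.FisherNonDegenerate pol ρ μF)
    (θ v : Param d) : μF * ‖v‖ ^ 2 ≤ inner ℝ (M.fisherMul pol ρ θ v) v := by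
  have h := (hF.2 θ).dotProduct_mulVec_nonneg v.ofLp
  rw [Matrix.sub_mulVec, Matrix.smul_mulVec, Matrix.one_mulVec, dotProduct_sub,
    dotProduct_smul] at h
  have h1 : inner ℝ (M.fisherMul pol ρ θ v) v =
      star v.ofLp ⬝ᵥ (M.fisher pol ρ θ).mulVec v.ofLp := by
    rw [EuclideanSpace.inner_eq_star_dotProduct]
    simp [MDP.fisherMul]
  have h2 : ‖v‖ ^ 2 = star v.ofLp ⬝ᵥ v.ofLp := by
    rw [← real_inner_self_eq_norm_sq, EuclideanSpace.inner_eq_star_dotProduct, dotProduct_comm]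
  rw [h1, h2]
  simpa using h

lemma MDP.FisherNonDegenerate.isUnit_det (hF : M.FisherNonDegenerate pol ρ μF) (θ : Param d) :
    IsUnit (M.fisher pol ρ θ).det := by
  have h : (M.fisher pol ρ θ).PosDef := by
    have := (Matrix.PosDef.one (n := Fin d) (R := ℝ)).smul hF.1
    simpa using this.add_posSemidef (hF.2 θ)
  exact h.det_pos.ne'.isUnit

lemma MDP.FisherNonDegenerate.fisherMul_fisherInv (hF : M.FisherNonDegenerate pol ρ μF)
    (θ v : Param d) : M.fisherMul pol ρ θ (M.fisherInv pol ρ θ v) = v := by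
  rw [MDP.fisherMul, MDP.fisherInv, Matrix.mulVec_mulVec,
    Matrix.mul_nonsing_inv _ (hF.isUnit_det θ), Matrix.one_mulVec]

lemma MDP.FisherNonDegenerate.norm_le (hF : M.FisherNonDegenerate pol ρ μF) (θ v : Param d) :
    μF * ‖v‖ ≤ ‖M.fisherMul pol ρ θ v‖ := by
  rcases (norm_nonneg v).eq_or_lt with h0 | h0
  · rw [← h0]; simp
  · refine le_of_mul_le_mul_right ?_ h0
    rw [mul_assoc, ← sq]
    exact (hF.le_inner_fisherMul_self θ v).trans (real_inner_le_norm _ _)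

end NonDegenerate

variable [IsProbabilityMeasure ρ]

instance (θ : Param d) : IsProbabilityMeasure (M.stateVisitation pol ρ θ) := by
  refine ⟨?_⟩
  have h1 : ∀ h : ℕ, ((M.trajLaw pol ρ θ).map fun τ => (τ h).1) Set.univ = 1 := fun h => by
    have : IsProbabilityMeasure ((M.trajLaw pol ρ θ).map fun τ => (τ h).1) :=
      Measure.isProbabilityMeasure_map
        (measurable_fst.comp (measurable_pi_apply h)).aemeasurable
    exact measure_univ
  have h0 : ∀ h : ℕ, 0 ≤ (1 - M.γ) * M.γ ^ h := fun h =>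
    mul_nonneg (sub_pos.2 M.γ_lt_one).le (pow_nonneg M.γ_nonneg h)
  have hs := M.hasSum_geometric.mul_left (1 - M.γ)
  rw [MDP.stateVisitation, Measure.sum_apply _ MeasurableSet.univ]
  simp only [Measure.smul_apply, h1, smul_eq_mul, mul_one]
  rw [← ENNReal.ofReal_tsum_of_nonneg h0 hs.summable, hs.tsum_eq,
    mul_one_div_cancel (sub_pos.2 M.γ_lt_one).ne', ENNReal.ofReal_one]

instance (θ : Param d) : IsProbabilityMeasure (M.visitation pol ρ θ) := by
  unfold MDP.visitation; infer_instance

variable {pol} {Mg Mh : ℝ}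

lemma PolicyClass.LogDensityBounds.inner_fisherMul (hlog : pol.LogDensityBounds Mg Mh)
    (θ v v' : Param d) : inner ℝ (M.fisherMul pol ρ θ v) v' =
      ∫ x, inner ℝ (pol.score θ x.1 x.2) v * inner ℝ (pol.score θ x.1 x.2) v'
        ∂(M.visitation pol ρ θ) := by
  have hm : ∀ i, Measurable fun x : S × A => pol.score θ x.1 x.2 i := fun i =>
    (measurable_pi_apply i).comp ((WithLp.measurable_ofLp 2 (Fin d → ℝ)).comp
      (hlog.measurable_score θ))
  have hb : ∀ i, ∀ x : S × A, |pol.score θ x.1 x.2 i| ≤ √Mg := fun i x =>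
    (PiLp.norm_apply_le (pol.score θ x.1 x.2) i).trans (hlog.norm_score_le _ _ _)
  have hint : ∀ i j, Integrable (fun x : S × A => pol.score θ x.1 x.2 i * pol.score θ x.1 x.2 j)
      (M.visitation pol ρ θ) := fun i j =>
    integrable_of_abs_le ((hm i).mul (hm j)) (√Mg * √Mg) fun x => by
      rw [abs_mul]
      exact mul_le_mul (hb i x) (hb j x) (abs_nonneg _) (Real.sqrt_nonneg _)
  have hexp : ∀ x : S × A, inner ℝ (pol.score θ x.1 x.2) v * inner ℝ (pol.score θ x.1 x.2) v' =
      ∑ i, ∑ j, (v' i * v j) * (pol.score θ x.1 x.2 i * pol.score θ x.1 x.2 j) := fun x => by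
    simp only [PiLp.inner_apply, RCLike.inner_apply, conj_trivial]
    rw [mul_comm, Finset.sum_mul_sum]
    exact Finset.sum_congr rfl fun i _ => Finset.sum_congr rfl fun j _ => by ring
  simp only [hexp]
  rw [integral_finsetSum _ fun i _ => integrable_finsetSum _ fun j _ => (hint i j).const_mul _]
  simp only [PiLp.inner_apply, RCLike.inner_apply, conj_trivial, MDP.fisherMul, Matrix.mulVec,
    dotProduct]
  refine Finset.sum_congr rfl fun i _ => ?_
  rw [integral_finsetSum _ fun j _ => (hint i j).const_mul _, Finset.mul_sum]
  refine Finset.sum_congr rfl fun j _ => ?_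
  rw [integral_const_mul, MDP.fisher, Matrix.of_apply]
  ring

lemma PolicyClass.LogDensityBounds.inner_fisherMul_comm (hlog : pol.LogDensityBounds Mg Mh)
    (θ v v' : Param d) :
    inner ℝ (M.fisherMul pol ρ θ v) v' = inner ℝ (M.fisherMul pol ρ θ v') v := by
  rw [hlog.inner_fisherMul M ρ, hlog.inner_fisherMul M ρ]
  simp only [mul_comm]

lemma PolicyClass.LogDensityBounds.inner_fisherMul_self_le (hlog : pol.LogDensityBounds Mg Mh)
    (hMg : 0 ≤ Mg) (θ v : Param d) : inner ℝ (M.fisherMul pol ρ θ v) v ≤ Mg * ‖v‖ ^ 2 := by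
  rw [hlog.inner_fisherMul M ρ]
  have := norm_integral_le_of_norm_le_const (μ := M.visitation pol ρ θ) (C := Mg * ‖v‖ ^ 2)
    (f := fun x => inner ℝ (pol.score θ x.1 x.2) v * inner ℝ (pol.score θ x.1 x.2) v)
    (Filter.Eventually.of_forall fun x => by
      have h : |inner ℝ (pol.score θ x.1 x.2) v| ≤ √Mg * ‖v‖ :=
        (abs_real_inner_le_norm _ _).trans
          (mul_le_mul_of_nonneg_right (hlog.norm_score_le _ _ _) (norm_nonneg _))
      rw [norm_mul, ← sq, Real.norm_eq_abs]
      refine (pow_le_pow_left₀ (abs_nonneg _) h 2).trans (le_of_eq ?_)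
      rw [mul_pow, Real.sq_sqrt hMg])
  exact (Real.le_norm_self _).trans (by simpa using this)

end Fisher

/-! ### One step of natural policy gradient ascent -/

/-- Progress of a step `α w` along an approximate natural gradient: `F` is the Fisher operator, `g`
the gradient, `gH` its truncation with bias at most `e`, `u` an estimate of `gH`, and `x = F⁻¹ g`,
`y = F⁻¹ u`. -/
lemma natural_gradient_step {E : Type*} [NormedAddCommGroup E] [InnerProductSpace ℝ E] {F : E → E}
    {g gH u w x y : E} {μF Mg L α e : ℝ} (hμ : 0 < μF) (hL : 0 < L) (hMg : 0 ≤ Mg)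
    (hα : 0 ≤ α) (hαL : α ≤ μF / (2 * L)) (hsub : ∀ v v', F (v - v') = F v - F v')
    (hcomm : ∀ v v', inner ℝ (F v) v' = inner ℝ (F v') v)
    (hle : ∀ v, inner ℝ (F v) v ≤ Mg * ‖v‖ ^ 2) (hge : ∀ v, μF * ‖v‖ ^ 2 ≤ inner ℝ (F v) v)
    (hnorm : ∀ v, μF * ‖v‖ ≤ ‖F v‖) (hx : F x = g) (hy : F y = u) (he : ‖g - gH‖ ≤ e) :
    α * μF / 2 * ‖x‖ ^ 2 + α * μF / 4 * ‖w‖ ^ 2 - 2 * α * Mg / μF ^ 2 * e ^ 2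
        - 2 * α * Mg / μF ^ 2 * ‖gH - u‖ ^ 2 - α * Mg * ‖w - y‖ ^ 2
      ≤ inner ℝ g (α • w) - L / 2 * ‖α • w‖ ^ 2 := by
  -- Polarization of the `F`-inner product of `x` and `w`.
  have h1 : 2 * inner ℝ g w = inner ℝ (F x) x + inner ℝ (F w) w - inner ℝ (F (w - x)) (w - x) := by
    rw [hsub, inner_sub_left, inner_sub_right, inner_sub_right, hcomm w x, hx]
    ring
  have h2 := hge x
  have h3 := hge w
  have h4 := hle (w - x)
  have hpar : ∀ p q : E, ‖p + q‖ ^ 2 ≤ 2 * ‖p‖ ^ 2 + 2 * ‖q‖ ^ 2 := fun p q => by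
    have := parallelogram_law_with_norm ℝ p q
    nlinarith [sq_nonneg ‖p - q‖]
  have h5 : ‖w - x‖ ^ 2 ≤ 2 * ‖w - y‖ ^ 2 + 2 * ‖y - x‖ ^ 2 := by
    simpa using hpar (w - y) (y - x)
  have h6 : ‖y - x‖ ^ 2 ≤ (2 * e ^ 2 + 2 * ‖gH - u‖ ^ 2) / μF ^ 2 := by
    rw [le_div_iff₀ (by positivity), mul_comm, ← mul_pow]
    have h7 := hnorm (y - x)
    rw [hsub, hx, hy] at h7
    have h8 : ‖u - g‖ ^ 2 ≤ 2 * ‖g - gH‖ ^ 2 + 2 * ‖gH - u‖ ^ 2 := by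
      rw [norm_sub_rev]
      simpa using hpar (g - gH) (gH - u)
    have h9 : ‖g - gH‖ ^ 2 ≤ e ^ 2 := pow_le_pow_left₀ (norm_nonneg _) he 2
    have h10 := pow_le_pow_left₀ (by positivity) h7 2
    linarith
  have h11 : L * α ≤ μF / 2 := by
    rw [le_div_iff₀ (by positivity)] at hαL
    linarith
  have h12 : L / 2 * (α ^ 2 * ‖w‖ ^ 2) ≤ α * μF / 4 * ‖w‖ ^ 2 := by
    have := mul_le_mul_of_nonneg_right h11 (mul_nonneg hα (sq_nonneg ‖w‖))
    linarith
  have h13 : α * Mg * ‖y - x‖ ^ 2 ≤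
      2 * α * Mg / μF ^ 2 * e ^ 2 + 2 * α * Mg / μF ^ 2 * ‖gH - u‖ ^ 2 := by
    refine (mul_le_mul_of_nonneg_left h6 (mul_nonneg hα hMg)).trans (le_of_eq ?_)
    ring
  have h14 : Mg * ‖w - x‖ ^ 2 ≤ Mg * (2 * ‖w - y‖ ^ 2 + 2 * ‖y - x‖ ^ 2) :=
    mul_le_mul_of_nonneg_left h5 hMg
  have h15 : α * (μF * ‖x‖ ^ 2 + μF * ‖w‖ ^ 2 - Mg * (2 * ‖w - y‖ ^ 2 + 2 * ‖y - x‖ ^ 2)) ≤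
      α * (2 * inner ℝ g w) := mul_le_mul_of_nonneg_left (by linarith) hα
  rw [inner_smul_right, norm_smul, mul_pow, Real.norm_eq_abs, sq_abs]
  linarith

end NPGHM

end

theorem mainTheorem3 {d : ℕ} {S A : Type*} [MeasurableSpace S] [MeasurableSpace A]
    (ν : Measure A) [SigmaFinite ν]
    (M : NPGHM.MDP S A) (pol : NPGHM.PolicyClass d S ν)
    (ρ : Measure S) [IsProbabilityMeasure ρ]
    (Mg Mh μF : ℝ) (hMg : 0 < Mg) (hMh : 0 < Mh)
    (hlog : pol.LogDensityBounds Mg Mh)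
    (hF : M.FisherNonDegenerate pol ρ μF)
    (H K : ℕ) (α β : ℕ → ℝ) (θ₁ : NPGHM.Param d) (w0 : ℕ → NPGHM.Param d)
    (ω : ℕ → NPGHM.Sample S A) (θ u w : ℕ → NPGHM.Param d)
    (hrun : M.IsRun pol Mg H K α β θ₁ w0 ω θ u w) :
    Differentiable ℝ (M.J pol ρ) ∧ Differentiable ℝ (M.JH pol ρ H) ∧
    ∀ t : ℕ, 1 ≤ t → 0 ≤ α t → α t ≤ μF / (2 * M.L Mg Mh) →
      M.J pol ρ (θ (t + 1)) ≥ M.J pol ρ (θ t)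
        + α t * μF / 2 * ‖M.fisherInv pol ρ (θ t) (∇ (M.J pol ρ) (θ t))‖ ^ 2
        + α t * μF / 4 * ‖w t‖ ^ 2
        - 2 * α t * Mg / μF ^ 2 * M.Gg Mg H ^ 2 * M.γ ^ (2 * H)
        - 2 * α t * Mg / μF ^ 2 * ‖∇ (M.JH pol ρ H) (θ t) - u t‖ ^ 2
        - α t * Mg * ‖w t - M.fisherInv pol ρ (θ t) (u t)‖ ^ 2 := by
  have hJ := hlog.hasGradientAt_J M ρ hMg.le hMh.le
  have hJH := hlog.hasGradientAt_JH M ρ hMg.le hMh.le H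
  refine ⟨fun x => (hJ x).differentiableAt, fun x => (hJH x).differentiableAt, ?_⟩
  intro t ht hα hαL
  have hL : 0 < M.L Mg Mh := by
    have : 0 < 1 - M.γ := sub_pos.2 M.γ_lt_one
    unfold NPGHM.MDP.L
    positivity
  have hstep := NPGHM.natural_gradient_step (F := M.fisherMul pol ρ (θ t))
    (gH := ∇ (M.JH pol ρ H) (θ t)) (w := w t) (L := M.L Mg Mh) hF.1 hL hMg.le hα hαL
    (M.fisherMul_sub pol ρ (θ t)) (hlog.inner_fisherMul_comm M ρ (θ t))
    (hlog.inner_fisherMul_self_le M ρ hMg.le (θ t)) (hF.le_inner_fisherMul_self (θ t))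
    (hF.norm_le (θ t)) (hF.fisherMul_fisherInv (θ t) (∇ (M.J pol ρ) (θ t)))
    (hF.fisherMul_fisherInv (θ t) (u t)) (e := M.Gg Mg H * M.γ ^ H)
    (by rw [(hJ _).gradient, (hJH _).gradient]; exact hlog.norm_gradJ_sub_le M ρ hMh.le H (θ t))
  have hsmooth := (abs_le.1 (hlog.abs_J_sub_le M ρ hMg.le hMh.le (θ t) (α t • w t))).1
  rw [← (hJ _).gradient, ← hrun.θ_succ t ht] at hsmooth
  rw [mul_pow, ← pow_mul, mul_comm H 2, ← mul_assoc] at hstep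
  linarith
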